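/- Let $\Sigma$ be a smooth 3-manifold with a smooth Riemannian metric $q$ and a dreibein $e$, i.e. a global smooth $q$-orthonormal frame $e_1,e_2,e_3$, which also fixes the orientation; let $e^a$ be the dual coframe, $\mathrm{Vol}_q=e^1\wedge e^2\wedge e^3$, $\star$ the Hodge star and $\nabla$ the Levi-Civita connection of $q$. Let $\tau_a=-\tfrac i2\sigma_a$ be the basis of $\mathfrak{su}(2)$ with $[\tau_b,\tau_c]=\epsilon^a{}_{bc}\tau_a$. Let $\beta\neq0$ be real and let $A=A^a\otimes\tau_a$ be a smooth $\mathfrak{su}(2)$-valued 1-form (the Ashtekar connection in the gauge $e$). Define $\Gamma=\Gamma^a\otimes\tau_a$ by $\nabla e_a=\Gamma^c\epsilon_{ca}{}^{b}e_b$, $\mathring K=K^a\otimes\tau_a:=\beta^{-1}(A-\Gamma)$, the reconstructed Weingarten map $W=K^a\otimes e_a$, $F=dA+\tfrac12[A\wedge A]$, $R=d\Gamma+\tfrac12[\Gamma\wedge\Gamma]$, and $*E=2\,(\star e^a)\otimes\tau_a$. Let $D$ be the connection on $T\Sigma$ with $De_a=A^b\epsilon_{ba}{}^{c}e_c$; the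 Gauss constraint is $$G_a:=\big(\mathrm{tr}(Y\mapsto\nabla_Ye_a)-\mathrm{tr}(Y\mapsto D_Ye_a)\big)\mathrm{Vol}_q=0,\qquad a=1,2,3.$$ Put $\mathrm{scal}_R:=\sum_{a,b}q(\mathrm{Riem}(e_a,e_b)e_a,e_b)$, where $\mathrm{Riem}(X,Y)=[\nabla_X,\nabla_Y]-\nabla_{[X,Y]}$ (so $\mathrm{scal}_R$ is minus the usual scalar curvature). The scalar constraint is the 3-form $$\mathcal S=\mathrm{tr}\Big(\star\big(F-\tfrac12(\beta^2+1)[\mathring K\wedge\mathring K]\big)\wedge *E\Big).$$ 1. In every positively oriented chart, with $F^a_{ij}=\partial_iA^a_j-\partial_jA^a_i+\epsilon^a{}_{bc}A^b_iA^c_j$ and $E^i_a=\sqrt{\det(q_{ij})}\,e^i_a$, $$\mathcal S=-\tfrac12\Big(F^a_{ij}-(\beta^2+1)\epsilon^a{}_{bc}K^b_iK^c_j\Big)\frac{\epsilon_a{}^{b'c'}E^i_{b'}E^j_{c'}}{\sqrt{\det(E^i_a)}}\;dx^1\wedge dx^2\wedge dx^3 .$$ 2. $F=R+\beta\,d\mathring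 K+\beta[\Gamma\wedge\mathring K]+\tfrac{\beta^2}2[\mathring K\wedge\mathring K]$. 3. If the Gauss constraint holds on $\Sigma$, then $$\mathcal S=\mathrm{tr}\Big(\star\big(R-\tfrac12[\mathring K\wedge\mathring K]\big)\wedge *E\Big)=-\tfrac12\Big(\mathrm{scal}_R+W^j_iW^i_j-(\mathrm{tr}\,W)^2\Big)\mathrm{Vol}_q .$$ Hence $\mathcal S=0$ at a point if and only if $\mathrm{scal}_R+W^j_iW^i_j-(\mathrm{tr}\,W)^2=0$ there. Moreover, in every chart and for every real $k\neq0$, writing $\sqrt q=\sqrt{\det(q_{ij})}$, let $K_{ij}=q(W\partial_i,\partial_j)$, $P^{ij}=\frac{\sqrt q}{k}(K^{ij}-q^{ij}K^l_l)$ and $$H=\frac{k}{\sqrt q}\big(q_{ik'}q_{jl}-\tfrac12q_{ij}q_{k'l}\big)P^{ij}P^{k'l}-\frac{\sqrt q}{k}\,\mathrm{Scal}$$ be the superhamiltonian, with $\mathrm{Scal}$ the usual scalar curvature of $q$. Then $H=\frac{\sqrt q}{k}\big(\mathrm{scal}_R+W^j_iW^i_j-(\mathrm{tr}\,W)^2\big)$,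 so that $\mathcal S=0$ at a point if and only if $H=0$ there. 4. The equation is the Gauss equation of a hypersurface in a Ricci-flat spacetime: if $(N,g)$ is a Ricci-flat Lorentzian 4-manifold, $\iota:\Sigma\to N$ a smooth embedding with $\iota^*g=q$, and $n$ a smooth vector field on a neighbourhood of $\iota(\Sigma)$ that is a unit timelike normal along $\iota(\Sigma)$ with $d\iota(WX)=\nabla^g_{d\iota X}n$ for all tangent vectors $X$ of $\Sigma$, then $\mathrm{scal}_R+W^j_iW^i_j-(\mathrm{tr}\,W)^2=0$ on all of $\Sigma$. -/

import Mathlib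

open scoped Manifold ContDiff Topology
open Bundle VectorField

noncomputable section

namespace Ashtekar

section LeviCivita

variable {E : Type*} [NormedAddCommGroup E] [NormedSpace ℝ E]
  {H : Type*} [TopologicalSpace H] {I : ModelWithCorners ℝ E H}
  {M : Type*} [TopologicalSpace M] [ChartedSpace H M] 

variable (I M) in
/-- A smooth pseudo-Riemannian metric on `M`. -/
structure PseudoRiemannianMetric [IsManifold I ∞ M] where
  inner (x : M) : TangentSpace I x →L[ℝ] TangentSpace I x →L[ℝ] ℝ
  symm (x : M) (v w : TangentSpace I x) : inner x v w = inner x w v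
  nondegenerate (x : M) (v : TangentSpace I x) : (∀ w, inner x v w = 0) → v = 0
  contMDiff : ContMDiff I (I.prod 𝓘(ℝ, E →L[ℝ] E →L[ℝ] ℝ)) ∞
    (fun x ↦ TotalSpace.mk' (E →L[ℝ] E →L[ℝ] ℝ) (E := fun x ↦ (TangentSpace I x →L[ℝ] TangentSpace I x →L[ℝ] ℝ)) x (inner x))

variable [IsManifold I ∞ M]

/-- `∇` is torsion free and compatible with `g`. As everywhere in Mathlib, `∇ Y x v` is `∇_v Y`. -/
structure IsLeviCivita (g : PseudoRiemannianMetric I M)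
    (nab : CovariantDerivative I E (TangentSpace I : M → Type _)) : Prop where
  torsionFree {X Y : Π x : M, TangentSpace I x} {x : M} (hX : MDiffAt (T% X) x)
    (hY : MDiffAt (T% Y) x) : nab Y x (X x) - nab X x (Y x) = mlieBracket I X Y x
  metric {Y Z : Π x : M, TangentSpace I x} {x : M} (hY : MDiffAt (T% Y) x)
    (hZ : MDiffAt (T% Z) x) (v : TangentSpace I x) :
    mvfderiv I (fun y ↦ g.inner y (Y y) (Z y)) x v
      = g.inner x (nab Y x v) (Z x) + g.inner x (Y x) (nab Z x v)

namespace PseudoRiemannianMetric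

variable (g : PseudoRiemannianMetric I M) {X X' Y Y' Z Z' : Π x : M, TangentSpace I x} {x : M}

lemma mdifferentiableAt (hY : MDiffAt (T% Y) x) (hZ : MDiffAt (T% Z) x) :
    MDiffAt (fun y ↦ g.inner y (Y y) (Z y)) x := by
  have h := (g.contMDiff.mdifferentiable (by simp) x)
  have := MDifferentiableAt.clm_bundle_apply₂ (F₁ := E) (F₂ := E) (F₃ := ℝ) (E₃ := Trivial M ℝ) h hY hZ
  simp only [mdifferentiableAt_totalSpace] at this
  exact this.2

/-- The Koszul functional, `2 g(∇_X Y, Z)`. -/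
def koszul (X Y Z : Π x : M, TangentSpace I x) (x : M) : ℝ :=
  mvfderiv I (fun y ↦ g.inner y (Y y) (Z y)) x (X x)
    + mvfderiv I (fun y ↦ g.inner y (X y) (Z y)) x (Y x)
    - mvfderiv I (fun y ↦ g.inner y (X y) (Y y)) x (Z x)
    + g.inner x (mlieBracket I X Y x) (Z x)
    - g.inner x (mlieBracket I X Z x) (Y x)
    - g.inner x (mlieBracket I Y Z x) (X x)

lemma d_smul_left {f : M → ℝ} (hf : MDiffAt f x) (hY : MDiffAt (T% Y) x) (hZ : MDiffAt (T% Z) x) :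
    mvfderiv I (fun y ↦ g.inner y ((f • Y) y) (Z y)) x
      = f x • mvfderiv I (fun y ↦ g.inner y (Y y) (Z y)) x
        + g.inner x (Y x) (Z x) • mvfderiv I f x := by
  have := mvfderiv_mul hf (g.mdifferentiableAt hY hZ)
  rw [← this]
  congr 1
  ext y
  simp

lemma d_smul_right {f : M → ℝ} (hf : MDiffAt f x) (hY : MDiffAt (T% Y) x) (hZ : MDiffAt (T% Z) x) :
    mvfderiv I (fun y ↦ g.inner y (Y y) ((f • Z) y)) x
      = f x • mvfderiv I (fun y ↦ g.inner y (Y y) (Z y)) x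
        + g.inner x (Y x) (Z x) • mvfderiv I f x := by
  have := mvfderiv_mul hf (g.mdifferentiableAt hY hZ)
  rw [← this]
  congr 1
  ext y
  simp

lemma d_add_left (hY : MDiffAt (T% Y) x) (hY' : MDiffAt (T% Y') x) (hZ : MDiffAt (T% Z) x) :
    mvfderiv I (fun y ↦ g.inner y ((Y + Y') y) (Z y)) x
      = mvfderiv I (fun y ↦ g.inner y (Y y) (Z y)) x
        + mvfderiv I (fun y ↦ g.inner y (Y' y) (Z y)) x := by
  have := mvfderiv_add (g.mdifferentiableAt hY hZ) (g.mdifferentiableAt hY' hZ)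
  rw [← this]
  congr 1
  ext y
  simp

lemma d_add_right (hY : MDiffAt (T% Y) x) (hZ : MDiffAt (T% Z) x) (hZ' : MDiffAt (T% Z') x) :
    mvfderiv I (fun y ↦ g.inner y (Y y) ((Z + Z') y)) x
      = mvfderiv I (fun y ↦ g.inner y (Y y) (Z y)) x
        + mvfderiv I (fun y ↦ g.inner y (Y y) (Z' y)) x := by
  have := mvfderiv_add (g.mdifferentiableAt hY hZ) (g.mdifferentiableAt hY hZ')
  rw [← this]
  congr 1
  ext y
  simp

lemma koszul_ext {v w : TangentSpace I x}
    (h : ∀ Z : Π x : M, TangentSpace I x, MDiffAt (T% Z) x →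
      g.inner x v (Z x) = g.inner x w (Z x)) : v = w := by
  rw [← sub_eq_zero]
  refine g.nondegenerate x _ fun z ↦ ?_
  have := h (FiberBundle.extend E z) (FiberBundle.mdifferentiableAt_extend ..)
  simp at this
  simp [this]

variable [FiniteDimensional ℝ E]

lemma tensorial_left (hY : MDiffAt (T% Y) x) (hZ : MDiffAt (T% Z) x) :
    TensorialAt I E (fun X ↦ g.koszul X Y Z x) x where
  smul {f σ} hf hX := by
    simp only [koszul, g.d_smul_left hf hX hZ, g.d_smul_left hf hX hY,
      mlieBracket_smul_left hf hX]
    simp [g.symm x _ (Y x), g.symm x _ (Z x)]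
    ring
  add {σ σ'} hX hX' := by
    simp only [koszul, g.d_add_left hX hX' hZ, g.d_add_left hX hX' hY,
      mlieBracket_add_left hX hX']
    simp
    ring

lemma tensorial_right (hX : MDiffAt (T% X) x) (hY : MDiffAt (T% Y) x) :
    TensorialAt I E (fun Z ↦ g.koszul X Y Z x) x where
  smul {f σ} hf hZ := by
    simp only [koszul, g.d_smul_right hf hX hZ, g.d_smul_right hf hY hZ,
      mlieBracket_smul_right hf hZ]
    simp [g.symm x _ (Y x), g.symm x _ (X x)]
    ring
  add {σ σ'} hZ hZ' := by
    simp only [koszul, g.d_add_right hX hZ hZ', g.d_add_right hY hZ hZ',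
      mlieBracket_add_right hZ hZ']
    simp
    ring

/-- The linear isomorphism `v ↦ g(v, ·)`. -/
lemma exists_inverse (x : M) : ∃ s : (TangentSpace I x →L[ℝ] ℝ) →L[ℝ] TangentSpace I x,
    ∀ φ w, g.inner x (s φ) w = φ w := by
  have : FiniteDimensional ℝ (TangentSpace I x) := inferInstanceAs (FiniteDimensional ℝ E)
  have : T2Space (TangentSpace I x) := inferInstanceAs (T2Space E)
  have hinj : Function.Injective ((g.inner x).toLinearMap) := by
    rw [← LinearMap.ker_eq_bot, LinearMap.ker_eq_bot']
    intro v hv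
    exact g.nondegenerate x v fun w ↦ by
      have := congrArg (fun φ : TangentSpace I x →L[ℝ] ℝ ↦ φ w) hv
      simpa using this
  have hdim : Module.finrank ℝ (TangentSpace I x)
      = Module.finrank ℝ (TangentSpace I x →L[ℝ] ℝ) := by
    rw [← (LinearMap.toContinuousLinearMap (𝕜 := ℝ) (E := TangentSpace I x) (F' := ℝ)).finrank_eq]
    exact (Subspace.dual_finrank_eq).symm
  let e := LinearEquiv.ofInjectiveOfFinrankEq _ hinj hdim
  refine ⟨LinearMap.toContinuousLinearMap e.symm.toLinearMap, fun φ w ↦ ?_⟩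
  have := e.apply_symm_apply φ
  exact congrArg (fun φ : TangentSpace I x →L[ℝ] ℝ ↦ φ w) this

/-- The fundamental theorem of pseudo-Riemannian geometry (existence). -/
theorem exists_isLeviCivita :
    ∃ nab : CovariantDerivative I E (TangentSpace I : M → Type _), IsLeviCivita g nab := by
  classical
  choose s hs using g.exists_inverse
  let F : (Π x : M, TangentSpace I x) → (Π x : M, TangentSpace I x →L[ℝ] TangentSpace I x) :=
    fun Y x ↦ if h : MDiffAt (T% Y) x then
      (s x).comp ((1 / 2 : ℝ) • TensorialAt.mkHom₂ (fun X Z ↦ g.koszul X Y Z x) x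
        (fun Z hZ ↦ g.tensorial_left h hZ) (fun X hX ↦ g.tensorial_right hX h)) else 0
  have key {X Y Z : Π x : M, TangentSpace I x} {x : M} (hX : MDiffAt (T% X) x)
      (hY : MDiffAt (T% Y) x) (hZ : MDiffAt (T% Z) x) :
      g.inner x (F Y x (X x)) (Z x) = 1 / 2 * g.koszul X Y Z x := by
    simp only [F, hY, dite_true, ContinuousLinearMap.comp_apply, hs]
    simp only [smul_apply, smul_eq_mul]
    rw [TensorialAt.mkHom₂_apply (Φ := fun X Z ↦ g.koszul X Y Z x) _ _ hX hZ]
  have fext {x : M} {L L' : TangentSpace I x →L[ℝ] TangentSpace I x}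
      (h : ∀ X Z : Π x : M, TangentSpace I x, MDiffAt (T% X) x → MDiffAt (T% Z) x →
        g.inner x (L (X x)) (Z x) = g.inner x (L' (X x)) (Z x)) : L = L' := by
    ext1 v
    refine g.koszul_ext fun Z hZ ↦ ?_
    simpa using h (FiberBundle.extend E v) Z (FiberBundle.mdifferentiableAt_extend ..) hZ
  refine ⟨⟨F, ⟨?_, ?_⟩⟩, ⟨?_, ?_⟩⟩
  · intro Y Y' x hY hY' _
    refine fext fun X Z hX hZ ↦ ?_
    rw [key hX (mdifferentiableAt_add_section hY hY') hZ]
    simp only [add_apply, map_add, key hX hY hZ, key hX hY' hZ]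
    simp only [koszul, g.d_add_left hY hY' hZ, g.d_add_right hX hY hY',
      mlieBracket_add_left hY hY', mlieBracket_add_right hY hY']
    simp
    ring
  · intro Y f x hY hf _
    refine fext fun X Z hX hZ ↦ ?_
    rw [key hX (hf.smul_section hY) hZ]
    simp only [add_apply, map_add, smul_apply, map_smul,
      key hX hY hZ, ContinuousLinearMap.smulRight_apply]
    simp only [koszul, g.d_smul_left hf hY hZ, g.d_smul_right hf hX hY,
      mlieBracket_smul_left hf hY, mlieBracket_smul_right hf hY]
    simp
    rw [g.symm x (X x) (Y x)]
    ring
  · intro X Y x hX hY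
    refine g.koszul_ext fun Z hZ ↦ ?_
    change g.inner x (F Y x (X x) - F X x (Y x)) (Z x) = _
    rw [map_sub, sub_apply, key hX hY hZ, key hY hX hZ]
    have h : (fun y ↦ g.inner y (X y) (Y y)) = fun y ↦ g.inner y (Y y) (X y) := by
      ext y; exact g.symm y _ _
    simp only [koszul, h]
    rw [mlieBracket_swap_apply (V := Y) (W := X)]
    simp
    ring
  · intro Y Z x hY hZ v
    change _ = g.inner x (F Y x v) (Z x) + g.inner x (Y x) (F Z x v)
    have hv := FiberBundle.mdifferentiableAt_extend (I := I) (F := E) (V := (TangentSpace I : M → Type _)) v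
    have h1 := key hv hY hZ
    have h2 := key hv hZ hY
    rw [FiberBundle.extend_apply_self] at h1 h2
    rw [g.symm x (Y x), h1, h2]
    have h : (fun y ↦ g.inner y (Y y) (Z y)) = fun y ↦ g.inner y (Z y) (Y y) := by
      ext y; exact g.symm y _ _
    simp only [koszul, h]
    rw [mlieBracket_swap_apply (V := Z) (W := Y)]
    simp
    ring

/-- The Levi-Civita connection. -/
def leviCivita : CovariantDerivative I E (TangentSpace I : M → Type _) :=
  g.exists_isLeviCivita.choose

lemma isLeviCivita_leviCivita : IsLeviCivita g g.leviCivita :=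
  g.exists_isLeviCivita.choose_spec

/-- The fundamental theorem of pseudo-Riemannian geometry (uniqueness). -/
theorem _root_.Ashtekar.IsLeviCivita.unique {nab nab' : CovariantDerivative I E (TangentSpace I : M → Type _)}
   (h : IsLeviCivita g nab) (h' : IsLeviCivita g nab') (hY : MDiffAt (T% Y) x) : nab Y x = nab' Y x := by
  have kz {nab : CovariantDerivative I E (TangentSpace I : M → Type _)} (h : IsLeviCivita g nab)
      {X Z : Π x : M, TangentSpace I x} (hX : MDiffAt (T% X) x) (hZ : MDiffAt (T% Z) x) :
      2 * g.inner x (nab Y x (X x)) (Z x) = g.koszul X Y Z x := by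
    simp only [koszul]
    rw [h.metric hY hZ, h.metric hX hZ, h.metric hX hY, ← h.torsionFree hX hY,
      ← h.torsionFree hX hZ, ← h.torsionFree hY hZ]
    simp [g.symm x _ (Y x), g.symm x _ (X x), g.symm x _ (Z x)]
    ring
  ext1 v
  refine g.koszul_ext fun Z hZ ↦ ?_
  have hv := FiberBundle.mdifferentiableAt_extend (I := I) (F := E) (V := (TangentSpace I : M → Type _)) v
  have h1 := kz h hv hZ
  have h2 := kz h' hv hZ
  rw [FiberBundle.extend_apply_self] at h1 h2
  linarith

end PseudoRiemannianMetric

/-- The curvature `R(X, Y) Z = ∇_X ∇_Y Z - ∇_Y ∇_X Z - ∇_[X, Y] Z`. -/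
def curvature (nab : CovariantDerivative I E (TangentSpace I : M → Type _))
    (X Y Z : Π x : M, TangentSpace I x) (x : M) : TangentSpace I x :=
  nab (fun y ↦ nab Z y (Y y)) x (X x) - nab (fun y ↦ nab Z y (X y)) x (Y x)
    - nab Z x (mlieBracket I X Y x)

end LeviCivita

section Spacetime

variable {N : Type*} [TopologicalSpace N] [ChartedSpace (EuclideanSpace ℝ (Fin 4)) N]
  [IsManifold (𝓡 4) ∞ N]

/-- Signature `(-, +, +, +)`. -/
def IsLorentzian (g : PseudoRiemannianMetric (𝓡 4) N) : Prop :=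
  ∀ x : N, ∃ v : Fin 4 → TangentSpace (𝓡 4) x, ∀ i j,
    g.inner x (v i) (v j) = if i = j then (if i = 0 then -1 else 1) else 0

/-- The Ricci tensor `Ric(Y, Z) = tr (X ↦ R(X, Y) Z)`, the trace being computed in a local
frame `s`. -/
def ricci (g : PseudoRiemannianMetric (𝓡 4) N) {u : Set N}
    {s : Fin 4 → Π x : N, TangentSpace (𝓡 4) x}
    (hs : IsLocalFrameOn (𝓡 4) (EuclideanSpace ℝ (Fin 4)) ∞ s u)
    (Y Z : Π x : N, TangentSpace (𝓡 4) x) (x : N) : ℝ :=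
  ∑ i, hs.coeff i x (curvature g.leviCivita (s i) Y Z x)

def IsRicciFlat (g : PseudoRiemannianMetric (𝓡 4) N) : Prop :=
  ∀ (u : Set N) (_ : IsOpen u) (s : Fin 4 → Π x : N, TangentSpace (𝓡 4) x)
    (hs : IsLocalFrameOn (𝓡 4) (EuclideanSpace ℝ (Fin 4)) ∞ s u)
    (Y Z : Π x : N, TangentSpace (𝓡 4) x),
    ContMDiffOn (𝓡 4) (𝓡 4).tangent ∞ (T% Y) u → ContMDiffOn (𝓡 4) (𝓡 4).tangent ∞ (T% Z) u → ∀ x ∈ u, ricci g hs Y Z x = 0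

end Spacetime

section LinearAlgebra

/-- The Levi-Civita symbol `ε_abc`. -/
def eps (a b c : Fin 3) : ℝ :=
  (((b : ℕ) : ℝ) - ((a : ℕ) : ℝ)) * (((c : ℕ) : ℝ) - ((a : ℕ) : ℝ))
    * (((c : ℕ) : ℝ) - ((b : ℕ) : ℝ)) / 2

/-- Complex `2 × 2` matrices; all Lie algebra valued forms below take values in the real span
`𝔰𝔲(2)` of the matrices `τ_a`. -/
abbrev Mat := Matrix (Fin 2) (Fin 2) ℂ

/-- The basis `τ_a = -(i/2) σ_a` of `𝔰𝔲(2)`, with `σ_a` the Pauli matrices. -/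
def tau : Fin 3 → Mat :=
  ![(-Complex.I / 2) • !![0, 1; 1, 0],
    (-Complex.I / 2) • !![0, -Complex.I; Complex.I, 0],
    (-Complex.I / 2) • !![1, 0; 0, -1]]

/-- `[τ_b, τ_c] = ε_abc τ_a`. -/
lemma tau_commutator (b c : Fin 3) :
    tau b * tau c - tau c * tau b = ∑ a, eps a b c • tau a := by
  fin_cases b <;> fin_cases c <;> ext i j <;> fin_cases i <;> fin_cases j <;>
    simp [tau, eps, Fin.sum_univ_three] <;> norm_num <;>
    simp [Complex.ext_iff] <;> norm_num

/-- The commutator as a bilinear map. -/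
def bracketMap : Mat →ₗ[ℝ] Mat →ₗ[ℝ] Mat :=
  LinearMap.mul ℝ Mat - (LinearMap.mul ℝ Mat).flip

/-- The trace form `(v, w) ↦ tr (v w)`, which is real valued on `𝔰𝔲(2)`. -/
def traceMap : Mat →ₗ[ℝ] Mat →ₗ[ℝ] ℝ :=
  (LinearMap.mul ℝ Mat).compr₂ (Complex.reLm ∘ₗ Matrix.traceLinearMap (Fin 2) ℝ ℂ)

variable {T V V₁ V₂ W : Type*} [AddCommGroup T] [Module ℝ T] [AddCommGroup V] [Module ℝ V]
  [AddCommGroup V₁] [Module ℝ V₁] [AddCommGroup V₂] [Module ℝ V₂] [AddCommGroup W] [Module ℝ W]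

/-- The wedge product of two 1-forms, values being multiplied by `B`. -/
def wedge₁₁ (B : V₁ →ₗ[ℝ] V₂ →ₗ[ℝ] W) (α : T →ₗ[ℝ] V₁) (β : T →ₗ[ℝ] V₂) :
    T [⋀^Fin 2]→ₗ[ℝ] W where
  toFun u := B (α (u 0)) (β (u 1)) - B (α (u 1)) (β (u 0))
  map_update_add' u i x y := by
    fin_cases i <;> simp [Function.update] <;> abel
  map_update_smul' u i c x := by
    fin_cases i <;> simp [Function.update, smul_sub]
  map_eq_zero_of_eq' u i j h hij := by
    fin_cases i <;> fin_cases j <;> simp_all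

lemma update_zero {S : Type*} (x y z : S) : Function.update ![x, y] 0 z = ![z, y] := by
  ext i; fin_cases i <;> simp

lemma update_one {S : Type*} (x y z : S) : Function.update ![x, y] 1 z = ![x, z] := by
  ext i; fin_cases i <;> simp

lemma two_add_left (β : T [⋀^Fin 2]→ₗ[ℝ] V) (x y z : T) :
    β ![x + y, z] = β ![x, z] + β ![y, z] := by
  have h := β.map_update_add ![x, z] 0 x y
  simpa only [update_zero] using h

lemma two_add_right (β : T [⋀^Fin 2]→ₗ[ℝ] V) (x y z : T) :
    β ![z, x + y] = β ![z, x] + β ![z, y] := by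
  have h := β.map_update_add ![z, x] 1 x y
  simpa only [update_one] using h

lemma two_smul_left (β : T [⋀^Fin 2]→ₗ[ℝ] V) (c : ℝ) (x z : T) :
    β ![c • x, z] = c • β ![x, z] := by
  have h := β.map_update_smul ![x, z] 0 c x
  simpa only [update_zero] using h

lemma two_smul_right (β : T [⋀^Fin 2]→ₗ[ℝ] V) (c : ℝ) (x z : T) :
    β ![z, c • x] = c • β ![z, x] := by
  have h := β.map_update_smul ![z, x] 1 c x
  simpa only [update_one] using h

lemma two_self (β : T [⋀^Fin 2]→ₗ[ℝ] V) (x : T) : β ![x, x] = 0 :=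
  β.map_eq_zero_of_eq ![x, x] (i := 0) (j := 1) rfl (by decide)

lemma two_swap (β : T [⋀^Fin 2]→ₗ[ℝ] V) (x y : T) : β ![x, y] = - β ![y, x] := by
  have h := two_self β (x + y)
  rw [two_add_left, two_add_right, two_add_right, two_self, two_self] at h
  simpa [add_eq_zero_iff_eq_neg] using h

/-- The wedge product of a 1-form and a 2-form, values being multiplied by `B`. -/
def wedge₁₂ (B : V₁ →ₗ[ℝ] V₂ →ₗ[ℝ] W) (α : T →ₗ[ℝ] V₁) (β : T [⋀^Fin 2]→ₗ[ℝ] V₂) :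
    T [⋀^Fin 3]→ₗ[ℝ] W where
  toFun u := B (α (u 0)) (β ![u 1, u 2]) - B (α (u 1)) (β ![u 0, u 2])
    + B (α (u 2)) (β ![u 0, u 1])
  map_update_add' := by
    intro inst u i x y
    obtain rfl : inst = instDecidableEqFin 3 := Subsingleton.elim _ _
    fin_cases i <;> simp [Function.update, two_add_left, two_add_right] <;> abel
  map_update_smul' := by
    intro inst u i c x
    obtain rfl : inst = instDecidableEqFin 3 := Subsingleton.elim _ _
    fin_cases i <;> simp [Function.update, two_smul_left, two_smul_right, smul_sub, smul_add]
  map_eq_zero_of_eq' u i j h hij := by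
    have h12 := two_swap β (u 1) (u 2)
    have h02 := two_swap β (u 0) (u 2)
    have h01 := two_swap β (u 0) (u 1)
    fin_cases i <;> fin_cases j <;> simp at h hij ⊢
    all_goals first
      | (rw [h] at *; simp [two_self]; done)
      | (rw [h01, h]; simp [two_self])

/-- `η ⊗ m` for a real valued `η`. -/
def tensor (m : V) {k : ℕ} (η : T [⋀^Fin k]→ₗ[ℝ] ℝ) : T [⋀^Fin k]→ₗ[ℝ] V :=
  (LinearMap.toSpanSingleton ℝ V m).compAlternatingMap η

/-- The 1-form `α^a ⊗ τ_a`. -/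
def su2One (α : Fin 3 → (T →ₗ[ℝ] ℝ)) : T →ₗ[ℝ] Mat :=
  ∑ a, (LinearMap.toSpanSingleton ℝ Mat (tau a)) ∘ₗ α a

/-- The 2-form `η^a ⊗ τ_a`. -/
def su2Two (η : Fin 3 → (T [⋀^Fin 2]→ₗ[ℝ] ℝ)) : T [⋀^Fin 2]→ₗ[ℝ] Mat :=
  ∑ a, tensor (tau a) (η a)

end LinearAlgebra

section Ashtekar

variable {M : Type*} [TopologicalSpace M] [ChartedSpace (EuclideanSpace ℝ (Fin 3)) M]

variable (M) in
/-- Vector fields on the 3-manifold `M`. -/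
abbrev Field := Π x : M, TangentSpace (𝓡 3) x

variable (M) in
/-- Real valued 1-forms on the 3-manifold `M`. -/
abbrev OneForm := Π x : M, TangentSpace (𝓡 3) x →L[ℝ] ℝ

variable [IsManifold (𝓡 3) ∞ M]

variable (M) in
/-- Smooth Riemannian metrics on the 3-manifold `M`. -/
abbrev Metric :=
  ContMDiffRiemannianMetric (𝓡 3) ∞ (EuclideanSpace ℝ (Fin 3))
    (fun x : M ↦ TangentSpace (𝓡 3) x)

/-- A Riemannian metric as a pseudo-Riemannian metric. -/
def toPseudo (q : Metric M) : PseudoRiemannianMetric (𝓡 3) M where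
  inner := q.inner
  symm := q.symm
  nondegenerate x v h := by
    by_contra hv
    exact (q.pos x v hv).ne' (h v)
  contMDiff := q.contMDiff

/-- A 1-form is smooth if it maps smooth vector fields to smooth functions. -/
def OneForm.Smooth (α : OneForm M) : Prop :=
  ∀ X : Field M, ContMDiff (𝓡 3) (𝓡 3).tangent ∞ (T% X) →
    ContMDiff (𝓡 3) 𝓘(ℝ, ℝ) ∞ fun x ↦ α x (X x)

/-- A dreibein: a global smooth `q`-orthonormal frame `e_1, e_2, e_3`. The manifold is oriented by
declaring it positive. -/
structure Dreibein (q : Metric M) where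
  e : Fin 3 → Field M
  contMDiff (a : Fin 3) : ContMDiff (𝓡 3) (𝓡 3).tangent ∞ (T% (e a))
  orthonormal (x : M) (a b : Fin 3) : q.inner x (e a x) (e b x) = if a = b then 1 else 0

namespace Dreibein

variable {q : Metric M} (d : Dreibein q)

/-- The Levi-Civita connection of `q`. -/
def nabla (_ : Dreibein q) :
    CovariantDerivative (𝓡 3) (EuclideanSpace ℝ (Fin 3)) (TangentSpace (𝓡 3) : M → Type _) :=
  (toPseudo q).leviCivita

/-- The dual coframe `e^a`. -/
def coframe (a : Fin 3) : OneForm M := fun x ↦ q.inner x (d.e a x)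

/-- The Riemannian volume form `Vol_q = e^1 ∧ e^2 ∧ e^3`. -/
def vol (x : M) : TangentSpace (𝓡 3) x [⋀^Fin 3]→ₗ[ℝ] ℝ :=
  (Matrix.detRowAlternating (n := Fin 3) (R := ℝ)).compLinearMap
    (LinearMap.pi fun a ↦ (d.coframe a x).toLinearMap)

/-- The Hodge star of a real 1-form, `⋆α = α^♯ ⌟ Vol_q`. -/
def star₁ {x : M} (α : TangentSpace (𝓡 3) x →ₗ[ℝ] ℝ) :
    TangentSpace (𝓡 3) x [⋀^Fin 2]→ₗ[ℝ] ℝ :=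
  (d.vol x).curryLeft (∑ a, α (d.e a x) • d.e a x)

/-- The Hodge star of a vector valued 2-form: `(⋆η)(e_c) = ½ ε_abc η(e_a, e_b)`. -/
def star₂ {V : Type*} [AddCommGroup V] [Module ℝ V] {x : M}
    (η : TangentSpace (𝓡 3) x [⋀^Fin 2]→ₗ[ℝ] V) : TangentSpace (𝓡 3) x →ₗ[ℝ] V :=
  ∑ a, ∑ b, ∑ c, (eps a b c / 2) •
    (LinearMap.toSpanSingleton ℝ V (η ![d.e a x, d.e b x])) ∘ₗ (d.coframe c x).toLinearMap

/-- The exterior derivative of a 1-form, expanded in the frame by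
`dα(e_a, e_b) = e_a(α(e_b)) - e_b(α(e_a)) - α([e_a, e_b])`. -/
def extD (α : OneForm M) (x : M) : TangentSpace (𝓡 3) x [⋀^Fin 2]→ₗ[ℝ] ℝ :=
  ∑ a, ∑ b, ((mvfderiv (𝓡 3) (fun y ↦ α y (d.e b y)) x (d.e a x)
      - mvfderiv (𝓡 3) (fun y ↦ α y (d.e a y)) x (d.e b x)
      - α x (mlieBracket (𝓡 3) (d.e a) (d.e b) x)) / 2) •
    wedge₁₁ (LinearMap.mul ℝ ℝ) (d.coframe a x).toLinearMap (d.coframe b x).toLinearMap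

/-- The `𝔰𝔲(2)`-valued 1-form `A = A^a ⊗ τ_a`. -/
def form (_ : Dreibein q) (A : Fin 3 → OneForm M) (x : M) : TangentSpace (𝓡 3) x →ₗ[ℝ] Mat :=
  su2One fun a ↦ (A a x).toLinearMap

/-- The exterior derivative `dA = dA^a ⊗ τ_a`. -/
def dForm (A : Fin 3 → OneForm M) (x : M) : TangentSpace (𝓡 3) x [⋀^Fin 2]→ₗ[ℝ] Mat :=
  su2Two fun a ↦ d.extD (A a) x

/-- `[A ∧ B]`, that is `[A ∧ B](u, v) = [A(u), B(v)] - [A(v), B(u)]`. -/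
def bracket (A B : Fin 3 → OneForm M) (x : M) : TangentSpace (𝓡 3) x [⋀^Fin 2]→ₗ[ℝ] Mat :=
  wedge₁₁ bracketMap (d.form A x) (d.form B x)

/-- The field strength `F = dA + ½ [A ∧ A]`. -/
def fieldStrength (A : Fin 3 → OneForm M) (x : M) : TangentSpace (𝓡 3) x [⋀^Fin 2]→ₗ[ℝ] Mat :=
  d.dForm A x + (1 / 2 : ℝ) • d.bracket A A x

/-- The Levi-Civita gauge potential: `∇ e_a = Γ^c ε_cab e_b`, that is
`Γ^c = ½ ε_cab q(∇ e_a, e_b)`. -/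
def Gam (c : Fin 3) : OneForm M := fun x ↦
  ∑ a, ∑ b, (eps c a b / 2) • (d.coframe b x).comp (d.nabla (d.e a) x)

/-- The components `K^a = (A^a - Γ^a) / β` of the `𝔰𝔲(2)`-valued 1-form `K̊`. -/
def K (β : ℝ) (A : Fin 3 → OneForm M) (a : Fin 3) : OneForm M := fun x ↦ β⁻¹ • (A a x - d.Gam a x)

/-- The reconstructed Weingarten map `W = K^a ⊗ e_a`. -/
def W (β : ℝ) (A : Fin 3 → OneForm M) (x : M) :
    TangentSpace (𝓡 3) x →ₗ[ℝ] TangentSpace (𝓡 3) x :=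
  ∑ a, (LinearMap.toSpanSingleton ℝ _ (d.e a x)) ∘ₗ (d.K β A a x).toLinearMap

/-- The covariant derivative induced by `A` on the tangent bundle, determined by the Leibniz rule
and `D e_a = A^b ε_bac e_c`. -/
def covA (A : Fin 3 → OneForm M) (X : Field M) (x : M) :
    TangentSpace (𝓡 3) x →L[ℝ] TangentSpace (𝓡 3) x :=
  ∑ a, (mvfderiv (𝓡 3) (fun y ↦ d.coframe a y (X y)) x).smulRight (d.e a x)
    + ∑ a, ∑ b, ∑ c, (d.coframe a x (X x) * eps b a c) • (A b x).smulRight (d.e c x)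

/-- The Gauss constraint `G_a = div_∇ E_a - div_D E_a`, where `E_a = Vol_q ⊗ e_a` and
`div_D E_a = tr (Y ↦ D_Y e_a) Vol_q`. -/
def gauss (A : Fin 3 → OneForm M) (a : Fin 3) (x : M) :
    TangentSpace (𝓡 3) x [⋀^Fin 3]→ₗ[ℝ] ℝ :=
  LinearMap.trace ℝ _ (d.nabla (d.e a) x).toLinearMap • d.vol x
    - LinearMap.trace ℝ _ (d.covA A (d.e a) x).toLinearMap • d.vol x

/-- The dual electric flux `*E = 2 ⋆(e_a)^♭ ⊗ τ_a`. -/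
def starE (x : M) : TangentSpace (𝓡 3) x [⋀^Fin 2]→ₗ[ℝ] Mat :=
  (2 : ℝ) • su2Two fun a ↦ d.star₁ (d.coframe a x).toLinearMap

/-- `tr(⋆η ∧ *E)` for an `𝔰𝔲(2)`-valued 2-form `η`. -/
def trStarWedge {x : M} (η : TangentSpace (𝓡 3) x [⋀^Fin 2]→ₗ[ℝ] Mat) :
    TangentSpace (𝓡 3) x [⋀^Fin 3]→ₗ[ℝ] ℝ :=
  wedge₁₂ traceMap (d.star₂ η) (d.starE x)

/-- The scalar constraint `S = tr(⋆(F - ½ (β² + 1) [K̊ ∧ K̊]) ∧ *E)`. -/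
def scalarConstraint (β : ℝ) (A : Fin 3 → OneForm M) (x : M) :
    TangentSpace (𝓡 3) x [⋀^Fin 3]→ₗ[ℝ] ℝ :=
  d.trStarWedge (d.fieldStrength A x
    - (1 / 2 * (β ^ 2 + 1)) • d.bracket (d.K β A) (d.K β A) x)

/-- `scal_R = ∑_ab q(R(e_a, e_b) e_a, e_b)`, which is minus the usual scalar curvature. -/
def scalR (x : M) : ℝ :=
  ∑ a, ∑ b, q.inner x (curvature d.nabla (d.e a) (d.e b) (d.e a) x) (d.e b x)

/-- The usual scalar curvature `∑_ab q(R(e_a, e_b) e_b, e_a)` (positive on round spheres). -/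
def scalarCurvature (x : M) : ℝ :=
  ∑ a, ∑ b, q.inner x (curvature d.nabla (d.e a) (d.e b) (d.e b) x) (d.e a x)

/-- `scal_R + W^j_i W^i_j - (tr W)²`. -/
def gaussExpr (β : ℝ) (A : Fin 3 → OneForm M) (x : M) : ℝ :=
  d.scalR x + LinearMap.trace ℝ _ (d.W β A x ∘ₗ d.W β A x)
    - (LinearMap.trace ℝ _ (d.W β A x)) ^ 2

/-! Expressions in a chart `φ`; everything is a function of the coordinates `y ∈ φ.target`. -/

variable (φ : OpenPartialHomeomorph M (EuclideanSpace ℝ (Fin 3)))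

/-- The coordinate vector `∂_i` at the point with coordinates `y`. -/
def partialVec (_ : Dreibein q) (i : Fin 3) (y : EuclideanSpace ℝ (Fin 3)) :
    TangentSpace (𝓡 3) (φ.symm y) :=
  mfderiv (𝓡 3) (𝓡 3) φ.symm y (EuclideanSpace.single i (1 : ℝ))

/-- The differentials `dx^i` at the point `x`. -/
def dx (_ : Dreibein q) (i : Fin 3) (x : M) : TangentSpace (𝓡 3) x →ₗ[ℝ] ℝ :=
  (EuclideanSpace.proj i : EuclideanSpace ℝ (Fin 3) →L[ℝ] ℝ).toLinearMap ∘ₗ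
    (mfderiv (𝓡 3) (𝓡 3) φ x).toLinearMap

/-- `dx^1 ∧ dx^2 ∧ dx^3` at the point `x`. -/
def dx₁₂₃ (x : M) : TangentSpace (𝓡 3) x [⋀^Fin 3]→ₗ[ℝ] ℝ :=
  (Matrix.detRowAlternating (n := Fin 3) (R := ℝ)).compLinearMap
    (LinearMap.pi fun i ↦ d.dx φ i x)

/-- The components `e^i_a`, with row index `i` and column index `a`. -/
def eUp (y : EuclideanSpace ℝ (Fin 3)) : Matrix (Fin 3) (Fin 3) ℝ :=
  Matrix.of fun i a ↦ d.dx φ i (φ.symm y) (d.e a (φ.symm y))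

/-- The components `α_i = α(∂_i)` of a 1-form. -/
def comp (α : OneForm M) (i : Fin 3) (y : EuclideanSpace ℝ (Fin 3)) : ℝ :=
  α (φ.symm y) (d.partialVec φ i y)

/-- The partial derivative `∂_i α_j`. -/
def dcomp (α : OneForm M) (i j : Fin 3) (y : EuclideanSpace ℝ (Fin 3)) : ℝ :=
  fderiv ℝ (d.comp φ α j) y (EuclideanSpace.single i (1 : ℝ))

/-- The metric components `q_ij`. -/
def qDown (y : EuclideanSpace ℝ (Fin 3)) : Matrix (Fin 3) (Fin 3) ℝ :=
  Matrix.of fun i j ↦ q.inner (φ.symm y) (d.partialVec φ i y) (d.partialVec φ j y)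

/-- `√q`, with `q = det (q_ij)`. -/
def sqrtq (y : EuclideanSpace ℝ (Fin 3)) : ℝ := √((d.qDown φ y).det)

/-- The densitized dreibein `E^i_a = √q e^i_a`. -/
def EUp (y : EuclideanSpace ℝ (Fin 3)) : Matrix (Fin 3) (Fin 3) ℝ := d.sqrtq φ y • d.eUp φ y

/-- `F^a_ij = ∂_i A^a_j - ∂_j A^a_i + ε_abc A^b_i A^c_j`. -/
def Fcomp (A : Fin 3 → OneForm M) (a i j : Fin 3) (y : EuclideanSpace ℝ (Fin 3)) : ℝ :=
  d.dcomp φ (A a) i j y - d.dcomp φ (A a) j i y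
    + ∑ b, ∑ c, eps a b c * d.comp φ (A b) i y * d.comp φ (A c) j y

/-- The coordinate expression of the scalar constraint,
`(F^a_ij - (β² + 1) ε_abc K^b_i K^c_j) ε_ab'c' E^i_b' E^j_c' / √(det E)`. -/
def scalarCoord (β : ℝ) (A : Fin 3 → OneForm M) (y : EuclideanSpace ℝ (Fin 3)) : ℝ :=
  ∑ a, ∑ i, ∑ j, ∑ b', ∑ c',
    (d.Fcomp φ A a i j y - (β ^ 2 + 1) *
        ∑ b, ∑ c, eps a b c * d.comp φ (d.K β A b) i y * d.comp φ (d.K β A c) j y)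
      * (eps a b' c' * d.EUp φ y i b' * d.EUp φ y j c') / √((d.EUp φ y).det)

/-- The extrinsic curvature `K_ij = q(W ∂_i, ∂_j)`. -/
def KDown (β : ℝ) (A : Fin 3 → OneForm M) (y : EuclideanSpace ℝ (Fin 3)) :
    Matrix (Fin 3) (Fin 3) ℝ :=
  Matrix.of fun i j ↦
    q.inner (φ.symm y) (d.W β A (φ.symm y) (d.partialVec φ i y)) (d.partialVec φ j y)

/-- The momenta `P^ij = (√q / k) (K^ij - q^ij K^l_l)`. -/
def PUp (k β : ℝ) (A : Fin 3 → OneForm M) (y : EuclideanSpace ℝ (Fin 3)) :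
    Matrix (Fin 3) (Fin 3) ℝ :=
  (d.sqrtq φ y / k) • ((d.qDown φ y)⁻¹ * d.KDown φ β A y * (d.qDown φ y)⁻¹
    - ((d.qDown φ y)⁻¹ * d.KDown φ β A y).trace • (d.qDown φ y)⁻¹)

/-- The superhamiltonian
`H = (k / √q) (q_ik q_jl - ½ q_ij q_kl) P^ij P^kl - (√q / k) R`. -/
def superHamiltonian (k β : ℝ) (A : Fin 3 → OneForm M) (y : EuclideanSpace ℝ (Fin 3)) : ℝ :=
  k / d.sqrtq φ y * (∑ i, ∑ j, ∑ m, ∑ l,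
      (d.qDown φ y i m * d.qDown φ y j l - 1 / 2 * d.qDown φ y i j * d.qDown φ y m l)
        * d.PUp φ k β A y i j * d.PUp φ k β A y m l)
    - d.sqrtq φ y / k * d.scalarCurvature (φ.symm y)

end Dreibein

/-- `(M, q)` with Weingarten map `W` is a spacelike hypersurface of the spacetime `(N, g)`: the map
`ι` is a smooth embedding with `ι^* g = q`, the field `n` is smooth near `ι(M)` and restricts to a
unit normal along `ι`, and `dι(W v) = ∇_{dι v} n`. -/
structure IsHypersurface {N : Type*} [TopologicalSpace N]
    [ChartedSpace (EuclideanSpace ℝ (Fin 4)) N] [IsManifold (𝓡 4) ∞ N]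
    (g : PseudoRiemannianMetric (𝓡 4) N) (q : Metric M)
    (W : Π x : M, TangentSpace (𝓡 3) x →ₗ[ℝ] TangentSpace (𝓡 3) x)
    (ι : M → N) (n : Π y : N, TangentSpace (𝓡 4) y) : Prop where
  embedding : Manifold.IsSmoothEmbedding (𝓡 3) (𝓡 4) ∞ ι
  isometric (x : M) (v w : TangentSpace (𝓡 3) x) :
    g.inner (ι x) (mfderiv (𝓡 3) (𝓡 4) ι x v) (mfderiv (𝓡 3) (𝓡 4) ι x w) = q.inner x v w
  smooth_normal : ∃ U : Set N, IsOpen U ∧ Set.range ι ⊆ U ∧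
    ContMDiffOn (𝓡 4) (𝓡 4).tangent ∞ (T% n) U
  unit (x : M) : g.inner (ι x) (n (ι x)) (n (ι x)) = -1
  normal (x : M) (v : TangentSpace (𝓡 3) x) :
    g.inner (ι x) (n (ι x)) (mfderiv (𝓡 3) (𝓡 4) ι x v) = 0
  weingarten (x : M) (v : TangentSpace (𝓡 3) x) :
    mfderiv (𝓡 3) (𝓡 4) ι x (W x v) = g.leviCivita n (ι x) (mfderiv (𝓡 3) (𝓡 4) ι x v)

end Ashtekar

end Ashtekar

end

/-! Evaluated on the dreibein, tr(⋆η ∧ *E) equals -½ ε_abc η^a(e_b, e_c) Vol_q (`trStarWedge_eq`):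
the factor 2 in *E and tr(τ_a τ_b) = -½ δ_ab combine, and only the totally antisymmetric part of the
components of η survives. The claims about the scalar constraint come down to this contraction.

In a chart, e^i_b e^j_c converts frame components into coordinate components; the exterior
derivative becomes ∂_i α_j - ∂_j α_i because the derivatives of e^i_a cancel against the brackets
[e_a, e_b] (`extD_e_eq_sum`). The quotient E E / √(det E) then supplies exactly the √q that relates
Vol_q to the coordinate volume.

Substituting A = Γ + βK̊ in F, the term (β²/2)[K̊ ∧ K̊] cancels against the constraint, leaving R -
½[K̊ ∧ K̊] plus β(dK̊ + [Γ ∧ K̊]). The Gauss constraint makes W symmetric (`K_symm_of_gauss`). Since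
∇ is torsion free, the ε-contraction of dK̊ + [Γ ∧ K̊] is an antisymmetrization of ∇W, which
vanishes for symmetric W (`sum_eps_covariantD_K`). What remains is algebra: R contracts to scal_R
(`scalR_eq`), and a product of two ε gives tr W² - (tr W)². The superhamiltonian is the same
quadratic expression, transported to the dreibein by a change of basis.

For a hypersurface, the dreibein is extended to ambient fields. The Koszul formula identifies the
tangential part of the ambient connection with ∇, and the Weingarten equation gives its normal part,
whence the Gauss equation. Combining Ric(n, n) = 0 with Ric(e_b, e_b) = 0 kills the sum of the
ambient sectional terms (`sum_inner_curvature_eq_zero`).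

On the analytic side, `leviCivita` is only chosen from an existence statement and carries no
regularity. Differentiability of ∇_X Y is therefore read off the Koszul formula, and curvature is
always handled through scalar functions (`inner_curvature`). -/

noncomputable section

namespace Ashtekar

/-! ### Derivatives of functions along vector fields, and the Lie bracket as a commutator. -/

section Calculus

variable {E : Type*} [NormedAddCommGroup E] [NormedSpace ℝ E]
  {M : Type*} [TopologicalSpace M] [ChartedSpace E M] [IsManifold 𝓘(ℝ, E) ∞ M]
  {F : Type*} [NormedAddCommGroup F] [NormedSpace ℝ F]

lemma isManifold_of_infty (n : ℕ) : IsManifold 𝓘(ℝ, E) n M :=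
  IsManifold.of_le (n := ∞) (by exact_mod_cast le_top)

lemma contMDiffAt_mvfderiv {f : M → F} {W : Π x : M, TangentSpace 𝓘(ℝ, E) x} {x : M}
    (hf : ContMDiffAt 𝓘(ℝ, E) 𝓘(ℝ, F) ∞ f x)
    (hW : ContMDiffAt 𝓘(ℝ, E) (𝓘(ℝ, E)).tangent ∞ (T% W) x) :
    ContMDiffAt 𝓘(ℝ, E) 𝓘(ℝ, F) ∞ (fun y ↦ mvfderiv 𝓘(ℝ, E) f y (W y)) x := by
  have h := hf.mfderiv_const (m := ∞) (by simp)
  have h2 := ContMDiffAt.clm_apply_of_inCoordinates (F₁ := E) (F₂ := F)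
    (E₁ := (TangentSpace 𝓘(ℝ, E) : M → Type _)) (E₂ := (TangentSpace 𝓘(ℝ, F) : F → Type _))
    (b₁ := id) (b₂ := f) (ϕ := mfderiv 𝓘(ℝ, E) 𝓘(ℝ, F) f) (v := W) h hW hf
  exact (contMDiff_snd_tangentBundle_modelSpace F 𝓘(ℝ, F)).contMDiffAt.comp x h2

/-- The representative of the vector field `V` in the chart at `x`. -/
def inChart (x : M) (V : Π x : M, TangentSpace 𝓘(ℝ, E) x) : E → E :=
  mpullbackWithin 𝓘(ℝ, E) 𝓘(ℝ, E) (extChartAt 𝓘(ℝ, E) x).symm V (Set.range 𝓘(ℝ, E))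

/-- The differential of `f` at `y`, computed in the chart at `x`. -/
lemma mvfderiv_eq_fderiv_comp_symm {f : M → ℝ} {x : M} {z : E}
    (hz : z ∈ (extChartAt 𝓘(ℝ, E) x).target)
    (hf : MDiffAt f ((extChartAt 𝓘(ℝ, E) x).symm z)) (V : Π x : M, TangentSpace 𝓘(ℝ, E) x) :
    mvfderiv 𝓘(ℝ, E) f ((extChartAt 𝓘(ℝ, E) x).symm z) (V ((extChartAt 𝓘(ℝ, E) x).symm z))
      = fderiv ℝ (f ∘ (extChartAt 𝓘(ℝ, E) x).symm) z
          (inChart x V z) := by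
  have : IsManifold 𝓘(ℝ, E) 1 M := isManifold_of_infty 1
  have hinv := isInvertible_mfderivWithin_extChartAt_symm hz
  have hd : MDiffAt (extChartAt 𝓘(ℝ, E) x).symm z := by
    have := mdifferentiableWithinAt_extChartAt_symm hz
    rwa [ModelWithCorners.Boundaryless.range_eq_univ, mdifferentiableWithinAt_univ] at this
  have hc := mvfderiv_comp_apply z hf hd
  have he : fderiv ℝ (f ∘ (extChartAt 𝓘(ℝ, E) x).symm) z
      = mvfderiv 𝓘(ℝ, E) (f ∘ (extChartAt 𝓘(ℝ, E) x).symm) z := by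
    rw [mvfderiv, mfderiv_eq_fderiv]; rfl
  rw [he]
  erw [hc]
  -- The pullback in `inChart` applies the inverse of the differential of the chart inverse, so it
  -- remains to cancel that invertible map.
  congr 1
  rw [inChart, mpullbackWithin_apply]
  rw [ModelWithCorners.Boundaryless.range_eq_univ] at hinv ⊢
  rw [mfderivWithin_univ] at hinv ⊢
  obtain ⟨L, hL⟩ := hinv
  rw [← hL, ContinuousLinearMap.inverse_equiv]
  exact (L.apply_symm_apply _).symm

lemma mvfderiv_eq_fderiv_comp_symm' {f : M → ℝ} {x : M}
    (hf : MDiffAt f x) (V : Π x : M, TangentSpace 𝓘(ℝ, E) x) :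
    mvfderiv 𝓘(ℝ, E) f x (V x)
      = fderiv ℝ (f ∘ (extChartAt 𝓘(ℝ, E) x).symm) (extChartAt 𝓘(ℝ, E) x x)
        (inChart x V (extChartAt 𝓘(ℝ, E) x x)) := by
  have hx := extChartAt_to_inv (I := 𝓘(ℝ, E)) x
  have := mvfderiv_eq_fderiv_comp_symm (x := x) (mem_extChartAt_target x) (f := f)
    (by rwa [hx]) V
  rw [← this]
  rw [hx]

variable [CompleteSpace E]

/-- The Lie bracket acts on functions as the commutator. -/
lemma mvfderiv_mlieBracket {f : M → ℝ} {V W : Π x : M, TangentSpace 𝓘(ℝ, E) x} {x : M}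
    (hf : ContMDiffAt 𝓘(ℝ, E) 𝓘(ℝ, ℝ) ∞ f x) (hV : MDiffAt (T% V) x) (hW : MDiffAt (T% W) x)
    (hfV : MDiffAt (fun y ↦ mvfderiv 𝓘(ℝ, E) f y (V y)) x)
    (hfW : MDiffAt (fun y ↦ mvfderiv 𝓘(ℝ, E) f y (W y)) x) :
    mvfderiv 𝓘(ℝ, E) f x (mlieBracket 𝓘(ℝ, E) V W x)
      = mvfderiv 𝓘(ℝ, E) (fun y ↦ mvfderiv 𝓘(ℝ, E) f y (W y)) x (V x)
        - mvfderiv 𝓘(ℝ, E) (fun y ↦ mvfderiv 𝓘(ℝ, E) f y (V y)) x (W x) := by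
  have i1 : IsManifold 𝓘(ℝ, E) 1 M := isManifold_of_infty 1
  have i2 : IsManifold 𝓘(ℝ, E) 2 M := isManifold_of_infty 2
  set φ := extChartAt 𝓘(ℝ, E) x with hφ
  have hfx : MDiffAt f x := hf.mdifferentiableAt (by simp)
  have hcf : ContDiffAt ℝ ∞ (f ∘ φ.symm) (φ x) := by
    have := (contMDiffAt_iff.1 hf).2
    rw [ModelWithCorners.Boundaryless.range_eq_univ, contDiffWithinAt_univ] at this
    exact this
  have pull {V : Π x : M, TangentSpace 𝓘(ℝ, E) x} (hV : MDiffAt (T% V) x) :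
      DifferentiableAt ℝ (inChart x V) (φ x) := by
    have := MDifferentiableWithinAt.differentiableWithinAt_mpullbackWithin_vectorField
      (s := Set.univ) (mdifferentiableWithinAt_univ.2 hV)
    rw [Set.preimage_univ, Set.univ_inter] at this
    change DifferentiableWithinAt ℝ (inChart x V) _ _ at this
    rwa [ModelWithCorners.Boundaryless.range_eq_univ, differentiableWithinAt_univ] at this
  have nbhd {V : Π x : M, TangentSpace 𝓘(ℝ, E) x} :
      (fun y ↦ mvfderiv 𝓘(ℝ, E) f y (V y)) ∘ φ.symm =ᶠ[𝓝 (φ x)]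
        fun z ↦ fderiv ℝ (f ∘ φ.symm) z
          (inChart x V z) := by
    have h1 : ∀ᶠ y in 𝓝 x, MDiffAt f y := by
      have : ContMDiffAt 𝓘(ℝ, E) 𝓘(ℝ, ℝ) 1 f x := hf.of_le (by simp)
      filter_upwards [(contMDiffAt_iff_contMDiffAt_nhds (by simp)).1 this] with y hy
      exact ContMDiffAt.mdifferentiableAt hy (by simp)
    have h2 : Filter.Tendsto φ.symm (𝓝 (φ x)) (𝓝 x) := by
      have := continuousAt_extChartAt_symm (I := 𝓘(ℝ, E)) x
      rwa [ContinuousAt, extChartAt_to_inv] at this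
    filter_upwards [h2.eventually h1, extChartAt_target_mem_nhds (I := 𝓘(ℝ, E)) x] with z hz hz'
    exact mvfderiv_eq_fderiv_comp_symm hz' hz V
  -- Product rule in the chart: V(Wf) = D²f(V, W) + Df(DW·V). After exchanging V and W and
  -- subtracting, the Hessian terms cancel by symmetry.
  have second {V W : Π x : M, TangentSpace 𝓘(ℝ, E) x} (hW : MDiffAt (T% W) x)
      (hfW : MDiffAt (fun y ↦ mvfderiv 𝓘(ℝ, E) f y (W y)) x) :
      mvfderiv 𝓘(ℝ, E) (fun y ↦ mvfderiv 𝓘(ℝ, E) f y (W y)) x (V x)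
        = fderiv ℝ (fderiv ℝ (f ∘ φ.symm)) (φ x)
            (inChart x V (φ x))
            (inChart x W (φ x))
          + fderiv ℝ (f ∘ φ.symm) (φ x)
            (fderiv ℝ (inChart x W) (φ x)
              (inChart x V (φ x))) := by
    rw [mvfderiv_eq_fderiv_comp_symm' hfW V, nbhd.fderiv_eq]
    have hd : DifferentiableAt ℝ (fderiv ℝ (f ∘ φ.symm)) (φ x) :=
      (hcf.fderiv_right (m := 1) (WithTop.coe_le_coe.2 le_top)).differentiableAt (by simp)
    erw [fderiv_clm_apply hd (pull hW)]
    simp only [add_apply, ContinuousLinearMap.comp_apply, ContinuousLinearMap.flip_apply]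
    rw [add_comm]
  rw [second (V := V) hW hfW, second (V := W) hV hfV]
  have symm := (hcf.isSymmSndFDerivAt (by rw [minSmoothness_of_isRCLikeNormedField]; exact WithTop.coe_le_coe.2 le_top)).eq
    (inChart x V (φ x))
    (inChart x W (φ x))
  rw [symm, mvfderiv_eq_fderiv_comp_symm' hfx (mlieBracket 𝓘(ℝ, E) V W)]
  -- The manifold bracket is the flat bracket of the chart representatives carried back to the
  -- manifold; passing to the chart again undoes this.
  have hb : inChart x (mlieBracket 𝓘(ℝ, E) V W) (φ x)
      = fderiv ℝ (inChart x W) (φ x) (inChart x V (φ x))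
        - fderiv ℝ (inChart x V) (φ x) (inChart x W (φ x)) := by
    rw [inChart, mpullbackWithin_apply]
    have e1 : φ.symm (φ x) = x := extChartAt_to_inv x
    rw [e1, ← mlieBracketWithin_univ, mlieBracketWithin_apply]
    have h1 := mfderiv_extChartAt_comp_mfderivWithin_extChartAt_symm'
      (mem_extChartAt_source (I := 𝓘(ℝ, E)) x)
    have h2 := mfderivWithin_extChartAt_symm_comp_mfderiv_extChartAt'
      (mem_extChartAt_source (I := 𝓘(ℝ, E)) x)
    rw [ContinuousLinearMap.inverse_eq h1 h2]
    erw [ContinuousLinearMap.inverse_eq h2 h1]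
    have h3 := fun w ↦ congrArg (fun L ↦ L w) h1
    simp only [ContinuousLinearMap.id_apply] at h3
    erw [h3]
    change lieBracketWithin ℝ (inChart x V) (inChart x W) _ _ = _
    rw [Set.preimage_univ, Set.univ_inter, ModelWithCorners.Boundaryless.range_eq_univ,
      lieBracketWithin_univ]
    rfl
  rw [hb, map_sub]
  ring

end Calculus

/-! ### Regularity of the Levi-Civita connection and symmetries of its curvature. -/

section Calculus

variable {E : Type*} [NormedAddCommGroup E] [NormedSpace ℝ E]
  {M : Type*} [TopologicalSpace M] [ChartedSpace E M] [IsManifold 𝓘(ℝ, E) ∞ M]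

omit [IsManifold 𝓘(ℝ, E) ∞ M] in
lemma mvfderiv_congr {f h : M → ℝ} {x : M} (hfh : f =ᶠ[𝓝 x] h) :
    mvfderiv 𝓘(ℝ, E) f x = mvfderiv 𝓘(ℝ, E) h x := by
  ext v
  change mfderiv 𝓘(ℝ, E) 𝓘(ℝ, ℝ) f x v = mfderiv 𝓘(ℝ, E) 𝓘(ℝ, ℝ) h x v
  rw [hfh.mfderiv_eq]
  rfl

omit [IsManifold 𝓘(ℝ, E) ∞ M] in
lemma mdifferentiableAt_finsetSum {ι : Type*} {f : ι → M → ℝ} {x : M}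
    (hf : ∀ i, MDiffAt (f i) x) (s : Finset ι) :
    MDiffAt (fun y ↦ ∑ i ∈ s, f i y) x ∧
      mvfderiv 𝓘(ℝ, E) (fun y ↦ ∑ i ∈ s, f i y) x = ∑ i ∈ s, mvfderiv 𝓘(ℝ, E) (f i) x := by
  classical
  induction s using Finset.induction_on with
  | empty => exact ⟨by simpa using mdifferentiableAt_const, by simp [mvfderiv_const]⟩
  | insert a s ha ih =>
    simp only [Finset.sum_insert ha]
    exact ⟨(hf a).add ih.1, by rw [← ih.2]; exact mvfderiv_add (hf a) ih.1⟩

omit [IsManifold 𝓘(ℝ, E) ∞ M] in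
lemma mdifferentiableAt_sum {ι : Type*} [Fintype ι] {f : ι → M → ℝ} {x : M}
    (hf : ∀ i, MDiffAt (f i) x) : MDiffAt (fun y ↦ ∑ i, f i y) x :=
  (mdifferentiableAt_finsetSum hf _).1

omit [IsManifold 𝓘(ℝ, E) ∞ M] in
lemma mvfderiv_sum {ι : Type*} [Fintype ι] {f : ι → M → ℝ} {x : M}
    (hf : ∀ i, MDiffAt (f i) x) :
    mvfderiv 𝓘(ℝ, E) (fun y ↦ ∑ i, f i y) x = ∑ i, mvfderiv 𝓘(ℝ, E) (f i) x :=
  (mdifferentiableAt_finsetSum hf _).2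

omit [IsManifold 𝓘(ℝ, E) ∞ M] in
lemma contMDiffAt_det {ι : Type*} [Fintype ι] [DecidableEq ι] {G : M → Matrix ι ι ℝ} {x : M}
    (hG : ∀ i j, ContMDiffAt 𝓘(ℝ, E) 𝓘(ℝ, ℝ) ∞ (fun y ↦ G y i j) x) :
    ContMDiffAt 𝓘(ℝ, E) 𝓘(ℝ, ℝ) ∞ (fun y ↦ (G y).det) x := by
  simp only [Matrix.det_apply']
  exact contMDiffAt_finsetSum fun σ _ ↦
    contMDiffAt_const.mul (contMDiffAt_finsetProd fun i _ ↦ hG _ _)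

-- Cramer's rule: each entry is a cofactor divided by the determinant. The case split below
-- separates the row that the adjugate replaces by a constant unit vector.
omit [IsManifold 𝓘(ℝ, E) ∞ M] in
lemma contMDiffAt_matrix_inv {ι : Type*} [Fintype ι] [DecidableEq ι] {G : M → Matrix ι ι ℝ}
    {x : M} (hG : ∀ i j, ContMDiffAt 𝓘(ℝ, E) 𝓘(ℝ, ℝ) ∞ (fun y ↦ G y i j) x)
    (hx : (G x).det ≠ 0) (i j : ι) :
    ContMDiffAt 𝓘(ℝ, E) 𝓘(ℝ, ℝ) ∞ (fun y ↦ (G y)⁻¹ i j) x := by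
  simp only [Matrix.inv_def, Ring.inverse_eq_inv', Matrix.smul_apply, Matrix.adjugate_apply,
    smul_eq_mul]
  refine ((contMDiffAt_det hG).inv₀ hx).mul (contMDiffAt_det fun a b ↦ ?_)
  by_cases h : a = j
  · subst h
    simpa using contMDiffAt_const
  · simpa [h] using hG a b

/-- Tangent vectors are separated by the differentials of smooth functions. -/
lemma eq_of_forall_mvfderiv_eq {x : M} {v w : TangentSpace 𝓘(ℝ, E) x}
    (h : ∀ f : M → ℝ, ContMDiffAt 𝓘(ℝ, E) 𝓘(ℝ, ℝ) ∞ f x →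
      mvfderiv 𝓘(ℝ, E) f x v = mvfderiv 𝓘(ℝ, E) f x w) : v = w := by
  have i1 : IsManifold 𝓘(ℝ, E) 1 M := isManifold_of_infty 1
  have hinv := isInvertible_mfderiv_extChartAt (mem_extChartAt_source (I := 𝓘(ℝ, E)) x)
  have hs : ContMDiffAt 𝓘(ℝ, E) 𝓘(ℝ, E) ∞ (extChartAt 𝓘(ℝ, E) x) x := contMDiffAt_extChartAt
  -- Linear functionals composed with the chart suffice as test functions; Hahn-Banach then
  -- separates points of the model space.
  have key : ∀ ℓ : E →L[ℝ] ℝ, ℓ (mfderiv 𝓘(ℝ, E) 𝓘(ℝ, E) (extChartAt 𝓘(ℝ, E) x) x v)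
      = ℓ (mfderiv 𝓘(ℝ, E) 𝓘(ℝ, E) (extChartAt 𝓘(ℝ, E) x) x w) := by
    intro ℓ
    have hl : ContMDiff 𝓘(ℝ, E) 𝓘(ℝ, ℝ) ∞ ℓ := ℓ.contMDiff
    have := h (ℓ ∘ extChartAt 𝓘(ℝ, E) x) (hl.contMDiffAt.comp x hs)
    rw [mvfderiv_comp_apply x (hl.mdifferentiable (by simp) _) (hs.mdifferentiableAt (by simp)),
      mvfderiv_comp_apply x (hl.mdifferentiable (by simp) _) (hs.mdifferentiableAt (by simp))]
      at this
    simp only [mvfderiv, mfderiv_eq_fderiv, ContinuousLinearMap.fderiv] at this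
    exact this
  obtain ⟨L, hL⟩ := hinv
  have h2 : mfderiv 𝓘(ℝ, E) 𝓘(ℝ, E) (extChartAt 𝓘(ℝ, E) x) x v
      = mfderiv 𝓘(ℝ, E) 𝓘(ℝ, E) (extChartAt 𝓘(ℝ, E) x) x w := by
    by_contra hne
    obtain ⟨ℓ, hℓ⟩ := SeparatingDual.exists_separating_of_ne (R := ℝ) (V := E) hne
    exact hℓ (key ℓ)
  rw [← hL] at h2
  exact L.injective h2

namespace PseudoRiemannianMetric

variable {g : PseudoRiemannianMetric 𝓘(ℝ, E) M} {u : Set M}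
  {X Y Z W : Π x : M, TangentSpace 𝓘(ℝ, E) x} {x : M}

lemma contMDiffAt_inner (g : PseudoRiemannianMetric 𝓘(ℝ, E) M)
    (hY : ContMDiffAt 𝓘(ℝ, E) (𝓘(ℝ, E)).tangent ∞ (T% Y) x)
    (hZ : ContMDiffAt 𝓘(ℝ, E) (𝓘(ℝ, E)).tangent ∞ (T% Z) x) :
    ContMDiffAt 𝓘(ℝ, E) 𝓘(ℝ, ℝ) ∞ (fun y ↦ g.inner y (Y y) (Z y)) x := by
  have := ContMDiffAt.clm_bundle_apply₂ (F₁ := E) (F₂ := E) (F₃ := ℝ) (E₃ := Trivial M ℝ)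
    g.contMDiff.contMDiffAt hY hZ
  simp only [contMDiffAt_totalSpace] at this
  exact this.2

variable [CompleteSpace E]

/-- Each of the six terms is a derivative of a smooth function or a product with a bracket of smooth
fields. This is the source of all regularity of the connection. -/
lemma mdifferentiableAt_koszul (g : PseudoRiemannianMetric 𝓘(ℝ, E) M)
    (hX : ContMDiffAt 𝓘(ℝ, E) (𝓘(ℝ, E)).tangent ∞ (T% X) x)
    (hY : ContMDiffAt 𝓘(ℝ, E) (𝓘(ℝ, E)).tangent ∞ (T% Y) x)
    (hZ : ContMDiffAt 𝓘(ℝ, E) (𝓘(ℝ, E)).tangent ∞ (T% Z) x) :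
    MDiffAt (g.koszul X Y Z) x := by
  have d {X Y Z : Π x : M, TangentSpace 𝓘(ℝ, E) x}
      (hX : ContMDiffAt 𝓘(ℝ, E) (𝓘(ℝ, E)).tangent ∞ (T% X) x)
      (hY : ContMDiffAt 𝓘(ℝ, E) (𝓘(ℝ, E)).tangent ∞ (T% Y) x)
      (hZ : ContMDiffAt 𝓘(ℝ, E) (𝓘(ℝ, E)).tangent ∞ (T% Z) x) :
      MDiffAt (fun x ↦ mvfderiv 𝓘(ℝ, E) (fun y ↦ g.inner y (Y y) (Z y)) x (X x)) x :=
    (contMDiffAt_mvfderiv (g.contMDiffAt_inner hY hZ) hX).mdifferentiableAt (by simp)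
  have b {X Y Z : Π x : M, TangentSpace 𝓘(ℝ, E) x}
      (hX : ContMDiffAt 𝓘(ℝ, E) (𝓘(ℝ, E)).tangent ∞ (T% X) x)
      (hY : ContMDiffAt 𝓘(ℝ, E) (𝓘(ℝ, E)).tangent ∞ (T% Y) x)
      (hZ : ContMDiffAt 𝓘(ℝ, E) (𝓘(ℝ, E)).tangent ∞ (T% Z) x) :
      MDiffAt (fun y ↦ g.inner y (mlieBracket 𝓘(ℝ, E) X Y y) (Z y)) x := by
    have h3 : IsManifold 𝓘(ℝ, E) ((⊤ : ℕ∞) + 1) M := ‹IsManifold 𝓘(ℝ, E) ∞ M›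
    have h2 : IsManifold 𝓘(ℝ, E) (minSmoothness ℝ 2) M := by
      rw [minSmoothness_of_isRCLikeNormedField]; exact isManifold_of_infty 2
    refine g.mdifferentiableAt ((ContMDiffAt.mlieBracket_vectorField (m := 1) (n := ⊤)
      hX hY (hmn := ?_)).mdifferentiableAt (by simp)) (hZ.mdifferentiableAt (by simp))
    · rw [minSmoothness_of_isRCLikeNormedField]
      exact WithTop.coe_le_coe.2 le_top
  exact (((((d hX hY hZ).add (d hY hX hZ)).sub (d hZ hX hY)).add (b hX hY hZ)).sub
    (b hX hZ hY)).sub (b hY hZ hX)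

variable [FiniteDimensional ℝ E]

omit [CompleteSpace E] in
/-- The Koszul formula. -/
lemma inner_leviCivita (g : PseudoRiemannianMetric 𝓘(ℝ, E) M) (hX : MDiffAt (T% X) x)
    (hY : MDiffAt (T% Y) x) (hZ : MDiffAt (T% Z) x) :
    g.inner x (g.leviCivita Y x (X x)) (Z x) = 1 / 2 * g.koszul X Y Z x := by
  have h := g.isLeviCivita_leviCivita
  simp only [koszul]
  rw [h.metric hY hZ, h.metric hX hZ, h.metric hX hY, ← h.torsionFree hX hY,
    ← h.torsionFree hX hZ, ← h.torsionFree hY hZ]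
  simp [g.symm x _ (Y x), g.symm x _ (X x), g.symm x _ (Z x)]
  ring

omit [CompleteSpace E] in
/-- A vector field is differentiable if its products with smooth fields are. -/
lemma mdifferentiableAt_of_inner (g : PseudoRiemannianMetric 𝓘(ℝ, E) M)
    {V : Π x : M, TangentSpace 𝓘(ℝ, E) x}
    (h : ∀ Z : Π x : M, TangentSpace 𝓘(ℝ, E) x,
      (∀ᶠ y in 𝓝 x, ContMDiffAt 𝓘(ℝ, E) (𝓘(ℝ, E)).tangent ∞ (T% Z) y) →
      MDiffAt (fun y ↦ g.inner y (V y) (Z y)) x) : MDiffAt (T% V) x := by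
  classical
  have i1 : IsManifold 𝓘(ℝ, E) 1 M := isManifold_of_infty 1
  let t := trivializationAt E (TangentSpace 𝓘(ℝ, E) : M → Type _) x
  have hxt : x ∈ t.baseSet := FiberBundle.mem_baseSet_trivializationAt E _ x
  let b := Module.finBasis ℝ E
  let s := t.localFrame b
  have hs : IsLocalFrameOn 𝓘(ℝ, E) E ∞ s t.baseSet :=
    t.isLocalFrameOn_localFrame_baseSet 𝓘(ℝ, E) ∞ b
  have hts := t.open_baseSet.mem_nhds hxt
  have hsc (j) : ∀ᶠ y in 𝓝 x, ContMDiffAt 𝓘(ℝ, E) (𝓘(ℝ, E)).tangent ∞ (T% (s j)) y := by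
    filter_upwards [hts] with y hy
    exact hs.contMDiffAt t.open_baseSet hy j
  let G : M → Matrix (Fin (Module.finrank ℝ E)) (Fin (Module.finrank ℝ E)) ℝ :=
    fun y ↦ Matrix.of fun i j ↦ g.inner y (s i y) (s j y)
  have hG (i j) : ContMDiffAt 𝓘(ℝ, E) 𝓘(ℝ, ℝ) ∞ (fun y ↦ G y i j) x :=
    g.contMDiffAt_inner (hsc i).self_of_nhds (hsc j).self_of_nhds
  -- A kernel vector of the Gram matrix gives a combination of the frame orthogonal to the whole
  -- frame, which nondegeneracy forces to vanish.
  have hdet : ∀ y ∈ t.baseSet, (G y).det ≠ 0 := by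
    intro y hy h0
    obtain ⟨c, hc, hc0⟩ := Matrix.exists_vecMul_eq_zero_iff.2 h0
    apply hc
    have hv : (∑ i, c i • s i y) = 0 := by
      refine g.nondegenerate y _ fun w ↦ ?_
      have hw : w ∈ Submodule.span ℝ (Set.range (s · y)) := hs.generating hy trivial
      induction hw using Submodule.span_induction with
      | mem w hw =>
        obtain ⟨j, rfl⟩ := hw
        have := congrFun hc0 j
        simpa [Matrix.vecMul, dotProduct, G] using this
      | zero => simp
      | add a b _ _ ha hb => rw [map_add, ha, hb, add_zero]
      | smul r a _ ha => rw [map_smul, ha, smul_zero]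
    ext i
    exact Fintype.linearIndependent_iff.1 (hs.linearIndependent hy) c hv i
  have hs1 : IsLocalFrameOn 𝓘(ℝ, E) E 1 s t.baseSet :=
    t.isLocalFrameOn_localFrame_baseSet 𝓘(ℝ, E) 1 b
  refine hs1.mdifferentiableAt_of_coeff (fun i ↦ ?_) hts
  -- The frame coefficients of V are its products with the frame times the inverse Gram matrix, so
  -- they inherit differentiability.
  have heq : (fun y ↦ hs1.coeff i y (V y)) =ᶠ[𝓝 x]
      fun y ↦ ∑ j, g.inner y (V y) (s j y) * (G y)⁻¹ j i := by
    filter_upwards [hts] with y hy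
    have h1 : (fun j ↦ g.inner y (V y) (s j y)) = Matrix.vecMul (fun i ↦ hs1.coeff i y (V y)) (G y) := by
      ext j
      conv_lhs => rw [hs1.coeff_sum_eq V hy]
      simp [Matrix.vecMul, dotProduct, G]
    have h2 : Matrix.vecMul (fun j ↦ g.inner y (V y) (s j y)) (G y)⁻¹
        = fun i ↦ hs1.coeff i y (V y) := by
      rw [h1, Matrix.vecMul_vecMul, Matrix.mul_nonsing_inv _ (hdet y hy).isUnit, Matrix.vecMul_one]
    exact (congrFun h2 i).symm
  refine MDifferentiableAt.congr_of_eventuallyEq ?_ heq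
  exact mdifferentiableAt_sum fun j ↦ (h _ (hsc j)).mul
    ((contMDiffAt_matrix_inv hG (hdet x hxt) j i).mdifferentiableAt (by simp))

/-- `∇_X Y` is differentiable if `X` and `Y` are smooth. -/
lemma mdifferentiableAt_leviCivita (g : PseudoRiemannianMetric 𝓘(ℝ, E) M) (hu : IsOpen u)
    (hX : ContMDiffOn 𝓘(ℝ, E) (𝓘(ℝ, E)).tangent ∞ (T% X) u)
    (hY : ContMDiffOn 𝓘(ℝ, E) (𝓘(ℝ, E)).tangent ∞ (T% Y) u) (hx : x ∈ u) :
    MDiffAt (T% (fun y ↦ g.leviCivita Y y (X y))) x := by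
  have hX' (y) (hy : y ∈ u) := hX.contMDiffAt (hu.mem_nhds hy)
  have hY' (y) (hy : y ∈ u) := hY.contMDiffAt (hu.mem_nhds hy)
  refine g.mdifferentiableAt_of_inner fun Z hZ ↦ ?_
  have hk := (g.mdifferentiableAt_koszul (hX' x hx) (hY' x hx) hZ.self_of_nhds).const_smul
    (1 / 2 : ℝ)
  refine hk.congr_of_eventuallyEq ?_
  filter_upwards [hZ, hu.mem_nhds hx] with y hy hyu
  exact g.inner_leviCivita ((hX' y hyu).mdifferentiableAt (by simp))
    ((hY' y hyu).mdifferentiableAt (by simp)) (hy.mdifferentiableAt (by simp))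

/-- The Riemann tensor in terms of derivatives of scalar functions. -/
lemma inner_curvature (g : PseudoRiemannianMetric 𝓘(ℝ, E) M) (hu : IsOpen u)
    (hX : ContMDiffOn 𝓘(ℝ, E) (𝓘(ℝ, E)).tangent ∞ (T% X) u)
    (hY : ContMDiffOn 𝓘(ℝ, E) (𝓘(ℝ, E)).tangent ∞ (T% Y) u)
    (hZ : ContMDiffOn 𝓘(ℝ, E) (𝓘(ℝ, E)).tangent ∞ (T% Z) u)
    (hW : MDiffAt (T% W) x) (hx : x ∈ u) :
    g.inner x (curvature g.leviCivita X Y Z x) (W x)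
      = mvfderiv 𝓘(ℝ, E) (fun y ↦ g.inner y (g.leviCivita Z y (Y y)) (W y)) x (X x)
        - g.inner x (g.leviCivita Z x (Y x)) (g.leviCivita W x (X x))
        - (mvfderiv 𝓘(ℝ, E) (fun y ↦ g.inner y (g.leviCivita Z y (X y)) (W y)) x (Y x)
          - g.inner x (g.leviCivita Z x (X x)) (g.leviCivita W x (Y x)))
        - g.inner x (g.leviCivita Z x (mlieBracket 𝓘(ℝ, E) X Y x)) (W x) := by
  have h := g.isLeviCivita_leviCivita
  -- Metric compatibility turns g(∇_X ∇_Y Z, W) into X g(∇_Y Z, W) - g(∇_Y Z, ∇_X W).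
  rw [h.metric (g.mdifferentiableAt_leviCivita hu hY hZ hx) hW,
    h.metric (g.mdifferentiableAt_leviCivita hu hX hZ hx) hW, curvature]
  simp

/-- Symmetrizing in Z and W leaves (XY - YX - [X, Y]) applied to the function g(Z, W), which is zero
because the bracket is the commutator. -/
lemma inner_curvature_antisymm (g : PseudoRiemannianMetric 𝓘(ℝ, E) M) (hu : IsOpen u)
    (hX : ContMDiffOn 𝓘(ℝ, E) (𝓘(ℝ, E)).tangent ∞ (T% X) u)
    (hY : ContMDiffOn 𝓘(ℝ, E) (𝓘(ℝ, E)).tangent ∞ (T% Y) u)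
    (hZ : ContMDiffOn 𝓘(ℝ, E) (𝓘(ℝ, E)).tangent ∞ (T% Z) u)
    (hW : ContMDiffOn 𝓘(ℝ, E) (𝓘(ℝ, E)).tangent ∞ (T% W) u) (hx : x ∈ u) :
    g.inner x (curvature g.leviCivita X Y Z x) (W x)
      = - g.inner x (curvature g.leviCivita X Y W x) (Z x) := by
  have h := g.isLeviCivita_leviCivita
  have at' {V : Π x : M, TangentSpace 𝓘(ℝ, E) x}
      (hV : ContMDiffOn 𝓘(ℝ, E) (𝓘(ℝ, E)).tangent ∞ (T% V) u) {y} (hy : y ∈ u) :=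
    hV.contMDiffAt (hu.mem_nhds hy)
  have md {V : Π x : M, TangentSpace 𝓘(ℝ, E) x}
      (hV : ContMDiffOn 𝓘(ℝ, E) (𝓘(ℝ, E)).tangent ∞ (T% V) u) {y} (hy : y ∈ u) :
      MDiffAt (T% V) y := (at' hV hy).mdifferentiableAt (by simp)
  have hdd {X Y : Π x : M, TangentSpace 𝓘(ℝ, E) x}
      (hY : ContMDiffOn 𝓘(ℝ, E) (𝓘(ℝ, E)).tangent ∞ (T% Y) u) :
      mvfderiv 𝓘(ℝ, E) (fun y ↦ g.inner y (g.leviCivita Z y (Y y)) (W y)) x (X x)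
        + mvfderiv 𝓘(ℝ, E) (fun y ↦ g.inner y (g.leviCivita W y (Y y)) (Z y)) x (X x)
      = mvfderiv 𝓘(ℝ, E) (fun y ↦ mvfderiv 𝓘(ℝ, E) (fun y ↦ g.inner y (Z y) (W y)) y (Y y))
          x (X x) := by
    have h1 := g.mdifferentiableAt (g.mdifferentiableAt_leviCivita hu hY hZ hx) (md hW hx)
    have h2 := g.mdifferentiableAt (g.mdifferentiableAt_leviCivita hu hY hW hx) (md hZ hx)
    rw [← add_apply, ← mvfderiv_add h1 h2]
    congr 1
    refine mvfderiv_congr ?_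
    filter_upwards [hu.mem_nhds hx] with y hy
    rw [h.metric (md hZ hy) (md hW hy), Pi.add_apply, g.symm y (Z y)]
  have hs := g.contMDiffAt_inner (at' hZ hx) (at' hW hx)
  have hb := mvfderiv_mlieBracket hs (md hX hx) (md hY hx)
    ((contMDiffAt_mvfderiv hs (at' hX hx)).mdifferentiableAt (by simp))
    ((contMDiffAt_mvfderiv hs (at' hY hx)).mdifferentiableAt (by simp))
  rw [← hdd hX, ← hdd hY, h.metric (md hZ hx) (md hW hx)] at hb
  rw [g.inner_curvature hu hX hY hZ (md hW hx) hx, g.inner_curvature hu hX hY hW (md hZ hx) hx]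
  rw [g.symm x (g.leviCivita W x (Y x)), g.symm x (g.leviCivita W x (X x)),
    g.symm x (g.leviCivita W x (mlieBracket 𝓘(ℝ, E) X Y x))]
  linarith

end PseudoRiemannianMetric

lemma curvature_swap (nab : CovariantDerivative 𝓘(ℝ, E) E (TangentSpace 𝓘(ℝ, E) : M → Type _))
    (X Y Z : Π x : M, TangentSpace 𝓘(ℝ, E) x) (x : M) :
    curvature nab X Y Z x = - curvature nab Y X Z x := by
  rw [curvature, curvature, mlieBracket_swap_apply, map_neg]
  abel

end Calculus

/-! ### Algebra of forms in the dreibein. -/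

section Algebra

variable {M : Type*} [TopologicalSpace M] [ChartedSpace (EuclideanSpace ℝ (Fin 3)) M]
  [IsManifold (𝓡 3) ∞ M]

lemma traceMap_tau (a b : Fin 3) : traceMap (tau a) (tau b) = if a = b then -(1 / 2) else 0 := by
  fin_cases a <;> fin_cases b <;>
    norm_num [traceMap, tau, Matrix.trace_fin_two, Complex.div_re, Complex.mul_re, Complex.mul_im,
      Complex.div_im]

lemma bracketMap_tau (b c : Fin 3) : bracketMap (tau b) (tau c) = ∑ a, eps a b c • tau a := by
  rw [← tau_commutator]; rfl

variable {T : Type*} [AddCommGroup T] [Module ℝ T]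

lemma su2One_apply (α : Fin 3 → (T →ₗ[ℝ] ℝ)) (u : T) : su2One α u = ∑ a, α a u • tau a := by
  simp [su2One]

lemma alternatingMap_sum_apply {V ι κ : Type*} [AddCommGroup V] [Module ℝ V] (s : Finset κ)
    (f : κ → T [⋀^ι]→ₗ[ℝ] V) (u : ι → T) : (∑ k ∈ s, f k) u = ∑ k ∈ s, f k u :=
  map_sum (⟨⟨fun g : T [⋀^ι]→ₗ[ℝ] V ↦ g u, rfl⟩, fun _ _ ↦ rfl⟩ : (T [⋀^ι]→ₗ[ℝ] V) →+ V) f s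

lemma su2Two_apply (η : Fin 3 → (T [⋀^Fin 2]→ₗ[ℝ] ℝ)) (u : Fin 2 → T) :
    su2Two η u = ∑ a, η a u • tau a := by
  simp [su2Two, tensor, alternatingMap_sum_apply]

namespace Dreibein

variable {q : Metric M} (d : Dreibein q) {x : M}

lemma coframe_e (a b : Fin 3) : d.coframe a x (d.e b x) = if a = b then 1 else 0 :=
  d.orthonormal x a b

/-- The dreibein as a basis of the tangent space. -/
def basis (x : M) : Module.Basis (Fin 3) ℝ (TangentSpace (𝓡 3) x) :=
  basisOfLinearIndependentOfCardEqFinrank (b := fun a ↦ d.e a x) (by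
    rw [Fintype.linearIndependent_iff]
    intro c hc b
    have := congrArg (d.coframe b x) hc
    simpa [d.coframe_e] using this) (by
    change _ = Module.finrank ℝ (EuclideanSpace ℝ (Fin 3))
    simp)

@[simp] lemma basis_apply (a : Fin 3) : d.basis x a = d.e a x := by simp [basis]

lemma sum_coframe_smul (v : TangentSpace (𝓡 3) x) : ∑ a, d.coframe a x v • d.e a x = v := by
  have h := (d.basis x).sum_repr v
  have hc (a) : d.coframe a x v = (d.basis x).repr v a := by
    conv_lhs => rw [← h]
    simp [d.coframe_e]
  conv_rhs => rw [← h]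
  simp [hc]

lemma inner_eq_sum (v w : TangentSpace (𝓡 3) x) :
    q.inner x v w = ∑ a, d.coframe a x v * d.coframe a x w := by
  conv_lhs => rw [← d.sum_coframe_smul v]
  simp [coframe]

lemma trace_eq_sum (L : TangentSpace (𝓡 3) x →ₗ[ℝ] TangentSpace (𝓡 3) x) :
    LinearMap.trace ℝ _ L = ∑ a, d.coframe a x (L (d.e a x)) := by
  rw [LinearMap.trace_eq_matrix_trace ℝ (d.basis x), Matrix.trace]
  refine Finset.sum_congr rfl fun a _ ↦ ?_
  rw [Matrix.diag_apply, LinearMap.toMatrix_apply, basis_apply]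
  conv_rhs => rw [← (d.basis x).sum_repr (L (d.e a x))]
  simp [d.coframe_e]

lemma twoForm_ext {V : Type*} [AddCommGroup V] [Module ℝ V]
    {η θ : TangentSpace (𝓡 3) x [⋀^Fin 2]→ₗ[ℝ] V}
    (h : ∀ a b, η ![d.e a x, d.e b x] = θ ![d.e a x, d.e b x]) : η = θ := by
  refine Module.Basis.ext_alternating (d.basis x) fun v _ ↦ ?_
  have : (fun i ↦ d.basis x (v i)) = ![d.e (v 0) x, d.e (v 1) x] := by
    ext i; fin_cases i <;> simp
  rw [this]
  exact h _ _

lemma vol_apply (u : Fin 3 → TangentSpace (𝓡 3) x) :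
    d.vol x u = (Matrix.of fun i a ↦ d.coframe a x (u i)).det := rfl

lemma vol_e : d.vol x ![d.e 0 x, d.e 1 x, d.e 2 x] = 1 := by
  rw [vol_apply, Matrix.det_fin_three]
  simp [d.coframe_e]

/-- Top-degree forms are a line, so identities between 3-forms need only be checked on the dreibein.
-/
lemma threeForm_eq (θ : TangentSpace (𝓡 3) x [⋀^Fin 3]→ₗ[ℝ] ℝ) :
    θ = θ ![d.e 0 x, d.e 1 x, d.e 2 x] • d.vol x := by
  have hb : ⇑(d.basis x) = ![d.e 0 x, d.e 1 x, d.e 2 x] := by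
    ext i; fin_cases i <;> simp
  have h1 := θ.eq_smul_basis_det (d.basis x)
  have h2 := (d.vol x).eq_smul_basis_det (d.basis x)
  rw [hb] at h1 h2
  rw [d.vol_e, one_smul] at h2
  rw [h2]
  exact h1

lemma vol_ne_zero : d.vol x ≠ 0 := fun h ↦ by
  have := d.vol_e (x := x)
  rw [h] at this
  simp at this

lemma bracket_apply (A B : Fin 3 → OneForm M) (u : Fin 2 → TangentSpace (𝓡 3) x) :
    d.bracket A B x u = ∑ a, (∑ b, ∑ c, eps a b c *
      (A b x (u 0) * B c x (u 1) - A b x (u 1) * B c x (u 0))) • tau a := by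
  have h (v w : TangentSpace (𝓡 3) x) : bracketMap (d.form A x v) (d.form B x w)
      = ∑ a, (∑ b, ∑ c, eps a b c * (A b x v * B c x w)) • tau a := by
    simp only [form, su2One_apply, map_sum, map_smul, LinearMap.sum_apply, LinearMap.smul_apply,
      bracketMap_tau, Finset.smul_sum, Finset.sum_smul, smul_smul, ContinuousLinearMap.coe_coe]
    rw [Finset.sum_comm]
    conv_rhs => rw [Finset.sum_comm]
    refine Finset.sum_congr rfl fun b _ ↦ ?_
    rw [Finset.sum_comm]
    refine Finset.sum_congr rfl fun c _ ↦ Finset.sum_congr rfl fun a _ ↦ ?_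
    congr 1; ring
  change bracketMap (d.form A x (u 0)) (d.form B x (u 1))
    - bracketMap (d.form A x (u 1)) (d.form B x (u 0)) = _
  rw [h, h, ← Finset.sum_sub_distrib]
  refine Finset.sum_congr rfl fun a _ ↦ ?_
  rw [← sub_smul]
  simp only [← Finset.sum_sub_distrib, mul_sub]

/-- The coefficients in `extD` are antisymmetric in the frame indices, so the division by 2 there
compensates for counting each pair twice. -/
lemma extD_e (α : OneForm M) (a b : Fin 3) :
    d.extD α x ![d.e a x, d.e b x] = mvfderiv (𝓡 3) (fun y ↦ α y (d.e b y)) x (d.e a x)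
      - mvfderiv (𝓡 3) (fun y ↦ α y (d.e a y)) x (d.e b x)
      - α x (mlieBracket (𝓡 3) (d.e a) (d.e b) x) := by
  have hw (a' b' : Fin 3) : wedge₁₁ (LinearMap.mul ℝ ℝ) (d.coframe a' x).toLinearMap
      (d.coframe b' x).toLinearMap ![d.e a x, d.e b x]
      = (if a' = a then 1 else 0) * (if b' = b then 1 else 0)
        - (if a' = b then 1 else 0) * (if b' = a then 1 else 0) := by
    simp [wedge₁₁, d.coframe_e]
  simp only [extD, alternatingMap_sum_apply, AlternatingMap.smul_apply, hw, smul_eq_mul, mul_sub,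
    Finset.sum_sub_distrib]
  simp only [mul_ite, mul_one, mul_zero, Finset.sum_ite_eq', Finset.mem_univ, if_true]
  rw [mlieBracket_swap_apply (V := d.e b) (W := d.e a)]
  simp
  ring

/-- The components of the curvature 2-form `dA^a + ½ ε_abc A^b ∧ A^c` in the dreibein. -/
lemma fieldStrength_apply (A : Fin 3 → OneForm M) (u v : TangentSpace (𝓡 3) x) :
    d.fieldStrength A x ![u, v]
      = ∑ a, (d.extD (A a) x ![u, v] + ∑ b, ∑ c, eps a b c * (A b x u * A c x v)) • tau a := by
  -- The antisymmetry of ε absorbs the factor ½ of ½[A ∧ A].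
  have h (a : Fin 3) : (1 / 2 : ℝ) * (∑ b, ∑ c, eps a b c * (A b x u * A c x v - A b x v * A c x u))
      = ∑ b, ∑ c, eps a b c * (A b x u * A c x v) := by
    fin_cases a <;> simp [Fin.sum_univ_three, eps] <;> ring
  simp only [fieldStrength, dForm, AlternatingMap.add_apply, AlternatingMap.smul_apply,
    su2Two_apply, d.bracket_apply, Finset.smul_sum, smul_smul, ← Finset.sum_add_distrib, add_smul]
  refine Finset.sum_congr rfl fun a _ ↦ ?_
  rw [← h a]
  rfl

/-- On the frame, ⋆e^a(e_b, e_c) = Vol_q(e_a, e_b, e_c) = ε_abc. -/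
lemma starE_e (b c : Fin 3) :
    d.starE x ![d.e b x, d.e c x] = ∑ a, (2 * eps a b c) • tau a := by
  simp only [starE, AlternatingMap.smul_apply, su2Two_apply, Finset.smul_sum, smul_smul]
  refine Finset.sum_congr rfl fun a _ ↦ ?_
  congr 2
  have : d.star₁ (d.coframe a x).toLinearMap ![d.e b x, d.e c x]
      = ∑ m, d.coframe a x (d.e m x) * d.vol x ![d.e m x, d.e b x, d.e c x] := by
    simp [star₁, alternatingMap_sum_apply]
  rw [this]
  simp only [vol_apply, Matrix.det_fin_three, Fin.sum_univ_three]
  simp [d.coframe_e]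
  fin_cases a <;> fin_cases b <;> fin_cases c <;> simp [eps] <;> norm_num

/-- `tr(⋆η ∧ *E)` in components. -/
lemma trStarWedge_eq {η : TangentSpace (𝓡 3) x [⋀^Fin 2]→ₗ[ℝ] Mat} {h : Fin 3 → Fin 3 → Fin 3 → ℝ}
    (hη : ∀ b c, η ![d.e b x, d.e c x] = ∑ a, h a b c • tau a) :
    d.trStarWedge η = (-(1 / 2) * ∑ a, ∑ b, ∑ c, eps a b c * h a b c) • d.vol x := by
  have hs (c : Fin 3) : d.star₂ η (d.e c x)
      = ∑ m, (∑ a, ∑ b, eps a b c / 2 * h m a b) • tau m := by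
    have h1 : d.star₂ η (d.e c x) = ∑ a, ∑ b, (eps a b c / 2) • η ![d.e a x, d.e b x] := by
      simp [star₂, LinearMap.sum_apply, d.coframe_e]
    rw [h1]
    simp only [hη, Finset.smul_sum, smul_smul, Finset.sum_smul]
    conv_rhs => rw [Finset.sum_comm]
    refine Finset.sum_congr rfl fun b _ ↦ ?_
    rw [Finset.sum_comm]
  -- The factor 2 in *E times the -½ of the trace form gives the sign. In the wedge product ε then
  -- picks m = c, so the result is minus the trace of the matrix of ⋆η.
  have ht (c b b' : Fin 3) : traceMap (d.star₂ η (d.e c x)) (d.starE x ![d.e b x, d.e b' x])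
      = - ∑ m, (∑ a, ∑ b, eps a b c / 2 * h m a b) * eps m b b' := by
    simp only [hs, d.starE_e, map_sum, LinearMap.sum_apply, map_smul, LinearMap.smul_apply,
      traceMap_tau, smul_eq_mul]
    simp [Fin.sum_univ_three]
    ring
  rw [d.threeForm_eq (d.trStarWedge η)]
  congr 1
  change traceMap (d.star₂ η (d.e 0 x)) (d.starE x ![d.e 1 x, d.e 2 x])
    - traceMap (d.star₂ η (d.e 1 x)) (d.starE x ![d.e 0 x, d.e 2 x])
    + traceMap (d.star₂ η (d.e 2 x)) (d.starE x ![d.e 0 x, d.e 1 x]) = _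
  rw [ht, ht, ht]
  simp [Fin.sum_univ_three, eps]
  ring

end Dreibein

end Algebra

/-! ### The Ashtekar connection, the Gauss constraint and the reduction of the scalar constraint. -/

section GaugeTheory

variable {M : Type*} [TopologicalSpace M] [ChartedSpace (EuclideanSpace ℝ (Fin 3)) M]
  [IsManifold (𝓡 3) ∞ M]

omit [IsManifold (𝓡 3) ∞ M] in
lemma mvfderiv_const_mul {f : M → ℝ} {x : M} (c : ℝ) (hf : MDifferentiableAt (𝓡 3) 𝓘(ℝ, ℝ) f x) :
    mvfderiv (𝓡 3) (fun y ↦ c * f y) x = c • mvfderiv (𝓡 3) f x := by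
  have := mvfderiv_mul (mdifferentiableAt_const (c := c)) hf
  rw [mvfderiv_const, smul_zero, add_zero] at this
  exact this

lemma sum_eps_mul_add (c : ℝ) (f h : Fin 3 → Fin 3 → Fin 3 → ℝ) :
    ∑ i, ∑ j, ∑ k, eps i j k * (f i j k + c * h i j k)
      = ∑ i, ∑ j, ∑ k, eps i j k * f i j k + c * ∑ i, ∑ j, ∑ k, eps i j k * h i j k := by
  simp only [Finset.mul_sum, ← Finset.sum_add_distrib]
  refine Finset.sum_congr rfl fun i _ ↦ Finset.sum_congr rfl fun j _ ↦
    Finset.sum_congr rfl fun k _ ↦ ?_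
  ring

namespace Dreibein

variable {q : Metric M} (d : Dreibein q) {x : M}

lemma mdifferentiableAt_e (a : Fin 3) : MDifferentiableAt (𝓡 3) (𝓡 3).tangent (T% (d.e a)) x :=
  (d.contMDiff a).mdifferentiableAt (by simp)

/-- The rotation coefficients `q(∇_v e_a, e_b)` in terms of the gauge potential. -/
lemma coframe_nabla_e (a b : Fin 3) (v : TangentSpace (𝓡 3) x) :
    d.coframe b x (d.nabla (d.e a) x v) = ∑ c, eps c a b * d.Gam c x v := by
  -- Differentiating the constant q(e_a, e_b) gives an antisymmetric matrix of rotation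
  -- coefficients, and in dimension 3 such a matrix is recovered from its ε-dual `Gam`.
  have anti (a b : Fin 3) : d.coframe b x (d.nabla (d.e a) x v)
      = - d.coframe a x (d.nabla (d.e b) x v) := by
    have h := (toPseudo q).isLeviCivita_leviCivita.metric (d.mdifferentiableAt_e (x := x) a)
      (d.mdifferentiableAt_e b) v
    have h0 : (fun y ↦ (toPseudo q).inner y (d.e a y) (d.e b y)) = fun _ ↦ if a = b then 1 else 0 :=
      funext fun y ↦ d.orthonormal y a b
    rw [h0, mvfderiv_const, (toPseudo q).symm x _ (d.e b x)] at h
    change 0 = d.coframe b x (d.nabla (d.e a) x v) + d.coframe a x (d.nabla (d.e b) x v) at h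
    linarith
  have h (c) : d.Gam c x v = ∑ a, ∑ b, eps c a b / 2 * d.coframe b x (d.nabla (d.e a) x v) := by
    simp [Gam, _root_.sum_apply]
  have h00 := anti 0 0
  have h11 := anti 1 1
  have h22 := anti 2 2
  have h10 := anti 1 0
  have h20 := anti 2 0
  have h21 := anti 2 1
  simp only [h]
  fin_cases a <;> fin_cases b <;> simp [Fin.sum_univ_three, eps] <;> linarith

lemma mdifferentiableAt_Gam (a b : Fin 3) : MDifferentiableAt (𝓡 3) 𝓘(ℝ, ℝ) (fun y ↦ d.Gam a y (d.e b y)) x := by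
  have h (c c' : Fin 3) : MDifferentiableAt (𝓡 3) 𝓘(ℝ, ℝ) (fun y ↦ d.coframe c' y (d.nabla (d.e c) y (d.e b y))) x :=
    (toPseudo q).mdifferentiableAt (d.mdifferentiableAt_e c')
      ((toPseudo q).mdifferentiableAt_leviCivita isOpen_univ (d.contMDiff b).contMDiffOn
        (d.contMDiff c).contMDiffOn (Set.mem_univ x))
  have h2 : (fun y ↦ d.Gam a y (d.e b y)) = fun y ↦ ∑ c, ∑ c', (eps a c c' / 2)
      * d.coframe c' y (d.nabla (d.e c) y (d.e b y)) := by
    ext y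
    simp [Gam, _root_.sum_apply]
  rw [h2]
  exact mdifferentiableAt_sum fun c ↦ mdifferentiableAt_sum fun c' ↦ (h c c').const_smul (eps a c c' / 2)

lemma mdifferentiableAt_smooth {α : OneForm M} (hα : α.Smooth) (b : Fin 3) :
    MDifferentiableAt (𝓡 3) 𝓘(ℝ, ℝ) (fun y ↦ α y (d.e b y)) x :=
  (hα _ (d.contMDiff b)).mdifferentiableAt (by simp)

lemma mdifferentiableAt_K {A : Fin 3 → OneForm M} (hA : ∀ a, (A a).Smooth) (β : ℝ) (a b : Fin 3) :
    MDifferentiableAt (𝓡 3) 𝓘(ℝ, ℝ) (fun y ↦ d.K β A a y (d.e b y)) x :=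
  ((d.mdifferentiableAt_smooth (hA a) b).sub (d.mdifferentiableAt_Gam a b)).const_smul β⁻¹

/-- Only frame components are assumed differentiable: this is what has been established for Γ and K,
and `extD` sees nothing else of a form's derivative. -/
lemma extD_add_smul {α γ : OneForm M} (c : ℝ) (hα : ∀ b, MDifferentiableAt (𝓡 3) 𝓘(ℝ, ℝ) (fun y ↦ α y (d.e b y)) x)
    (hγ : ∀ b, MDifferentiableAt (𝓡 3) 𝓘(ℝ, ℝ) (fun y ↦ γ y (d.e b y)) x) :
    d.extD (fun y ↦ α y + c • γ y) x = d.extD α x + c • d.extD γ x := by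
  have h (b) : mvfderiv (𝓡 3) (fun y ↦ (α y + c • γ y) (d.e b y)) x
      = mvfderiv (𝓡 3) (fun y ↦ α y (d.e b y)) x
        + c • mvfderiv (𝓡 3) (fun y ↦ γ y (d.e b y)) x := by
    have h1 := mvfderiv_add (hα b) ((hγ b).const_smul c)
    rw [show (c • fun y ↦ γ y (d.e b y)) = fun y ↦ c * γ y (d.e b y) from rfl,
      mvfderiv_const_mul c (hγ b)] at h1
    exact h1
  refine d.twoForm_ext fun a b ↦ ?_
  simp only [AlternatingMap.add_apply, AlternatingMap.smul_apply, d.extD_e, h]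
  simp
  ring

lemma eq_Gam_add_K {β : ℝ} (hβ : β ≠ 0) (A : Fin 3 → OneForm M) (a : Fin 3) :
    A a = fun y ↦ d.Gam a y + β • d.K β A a y := by
  ext y v
  simp [K, hβ]

/-- Expand with A = Γ + βK̊. On 1-forms the bracket is symmetric, [Γ ∧ K̊] = [K̊ ∧ Γ], so the two
cross terms absorb the factor ½. -/
theorem fieldStrength_eq {A : Fin 3 → OneForm M} (hA : ∀ a, (A a).Smooth) {β : ℝ} (hβ : β ≠ 0)
    (x : M) : d.fieldStrength A x = d.fieldStrength d.Gam x + β • d.dForm (d.K β A) x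
      + β • d.bracket d.Gam (d.K β A) x + (β ^ 2 / 2) • d.bracket (d.K β A) (d.K β A) x := by
  have hd (a) : d.extD (A a) x = d.extD (d.Gam a) x + β • d.extD (d.K β A a) x := by
    conv_lhs => rw [d.eq_Gam_add_K hβ A a]
    exact d.extD_add_smul β (d.mdifferentiableAt_Gam a) (d.mdifferentiableAt_K hA β a)
  have hv (a) (v : TangentSpace (𝓡 3) x) : A a x v = d.Gam a x v + β * d.K β A a x v := by
    conv_lhs => rw [d.eq_Gam_add_K hβ A a]
    rfl
  refine d.twoForm_ext fun a b ↦ ?_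
  simp only [AlternatingMap.add_apply, AlternatingMap.smul_apply, fieldStrength_apply, dForm,
    su2Two_apply, bracket_apply, Finset.smul_sum, smul_smul, ← Finset.sum_add_distrib, ← add_smul,
    hd, hv]
  refine Finset.sum_congr rfl fun m _ ↦ ?_
  congr 1
  simp only [Matrix.cons_val_zero, Matrix.cons_val_one, smul_eq_mul]
  fin_cases m <;> simp [Fin.sum_univ_three, eps] <;> ring

lemma trace_W (β : ℝ) (A : Fin 3 → OneForm M) :
    LinearMap.trace ℝ _ (d.W β A x) = ∑ a, d.K β A a x (d.e a x) := by
  rw [d.trace_eq_sum]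
  simp [W, d.coframe_e]

lemma trace_W_comp_W (β : ℝ) (A : Fin 3 → OneForm M) :
    LinearMap.trace ℝ _ (d.W β A x ∘ₗ d.W β A x)
      = ∑ a, ∑ b, d.K β A b x (d.e a x) * d.K β A a x (d.e b x) := by
  rw [d.trace_eq_sum]
  simp [W, d.coframe_e]

/-- The Gauss constraint says that the Weingarten map is symmetric. -/
lemma K_symm_of_gauss {A : Fin 3 → OneForm M} {β : ℝ} (hβ : β ≠ 0)
    (hG : ∀ a, d.gauss A a x = 0) (a b : Fin 3) :
    d.K β A a x (d.e b x) = d.K β A b x (d.e a x) := by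
  have hv (a) (v : TangentSpace (𝓡 3) x) : A a x v = d.Gam a x v + β * d.K β A a x v := by
    conv_lhs => rw [d.eq_Gam_add_K hβ A a]
    rfl
  -- The Γ-parts of the two divergences agree, and β ≠ 0 can be divided out of the rest. What
  -- remains is the ε-dual of the antisymmetric part of K^c(e_b).
  have h (a) : ∑ b, ∑ c, eps c a b * d.K β A c x (d.e b x) = 0 := by
    have h0 := hG a
    replace h0 := congrArg (fun η ↦ η ![d.e 0 x, d.e 1 x, d.e 2 x]) h0
    simp only [gauss, AlternatingMap.sub_apply, AlternatingMap.smul_apply, d.vol_e, smul_eq_mul,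
      mul_one, AlternatingMap.zero_apply, sub_eq_zero, d.trace_eq_sum] at h0
    -- The frame coefficients of e_a are constant, so the derivative part of `covA` drops out.
    have h2 (b : Fin 3) : d.coframe b x (d.covA A (d.e a) x (d.e b x))
        = ∑ c, eps c a b * A c x (d.e b x) := by
      simp [covA, mvfderiv_const, _root_.sum_apply, d.coframe_e]
    simp only [ContinuousLinearMap.coe_coe, d.coframe_nabla_e, h2, hv] at h0
    have h3 : β * ∑ b, ∑ c, eps c a b * d.K β A c x (d.e b x) = 0 := by
      simp only [mul_add, Finset.sum_add_distrib] at h0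
      simp only [Finset.mul_sum]
      rw [left_eq_add] at h0
      rw [← h0]
      exact Finset.sum_congr rfl fun b _ ↦ Finset.sum_congr rfl fun c _ ↦ by ring
    exact (mul_eq_zero.1 h3).resolve_left hβ
  have h0 := h 0
  have h1 := h 1
  have h2 := h 2
  simp [Fin.sum_univ_three, eps] at h0 h1 h2
  fin_cases a <;> fin_cases b <;> simp <;> linarith

/-- Torsion-freeness, [e_a, e_b] = ∇_{e_a} e_b - ∇_{e_b} e_a, written with the rotation
coefficients; this is the first structure equation in dual form. -/
lemma coframe_mlieBracket (a b m : Fin 3) :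
    d.coframe m x (mlieBracket (𝓡 3) (d.e a) (d.e b) x)
      = ∑ c, (eps c b m * d.Gam c x (d.e a x) - eps c a m * d.Gam c x (d.e b x)) := by
  rw [← (toPseudo q).isLeviCivita_leviCivita.torsionFree (d.mdifferentiableAt_e a)
    (d.mdifferentiableAt_e b), map_sub]
  change d.coframe m x (d.nabla (d.e b) x (d.e a x)) - d.coframe m x (d.nabla (d.e a) x (d.e b x))
    = _
  rw [d.coframe_nabla_e, d.coframe_nabla_e, Finset.sum_sub_distrib]

lemma apply_eq_sum (α : OneForm M) (v : TangentSpace (𝓡 3) x) :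
    α x v = ∑ m, d.coframe m x v * α x (d.e m x) := by
  conv_lhs => rw [← d.sum_coframe_smul v]
  simp

/-- The covariant exterior derivative of a symmetric `K` has no totally antisymmetric part. -/
lemma sum_eps_covariantD_K {κ : Fin 3 → OneForm M}
    (hs : ∀ a b y, κ a y (d.e b y) = κ b y (d.e a y)) :
    ∑ a, ∑ b, ∑ c, eps a b c * (d.extD (κ a) x ![d.e b x, d.e c x]
      + ∑ m, ∑ n, eps a m n * (d.Gam m x (d.e b x) * κ n x (d.e c x)
        - d.Gam m x (d.e c x) * κ n x (d.e b x))) = 0 := by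
  -- With the brackets expressed through Γ, the sum becomes an antisymmetrization of ∇κ, which is
  -- symmetric in the two slots of κ.
  simp only [d.extD_e, fun a b c ↦ d.apply_eq_sum (κ a) (mlieBracket (𝓡 3) (d.e b) (d.e c) x),
    d.coframe_mlieBracket]
  -- Symmetry is needed as an identity of functions, because the components are also differentiated.
  have h10 := funext (hs 1 0)
  have h20 := funext (hs 2 0)
  have h21 := funext (hs 2 1)
  have k10 := hs 1 0 x
  have k20 := hs 2 0 x
  have k21 := hs 2 1 x
  simp [Fin.sum_univ_three, eps, h10, h20, h21, k10, k20, k21]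
  ring

/-- The curvature of the Levi-Civita connection in terms of the gauge potential. -/
lemma scalR_eq : d.scalR x = ∑ n, ∑ a, ∑ b, eps n a b * (d.extD (d.Gam n) x ![d.e a x, d.e b x]
    + ∑ m, ∑ l, eps n m l * (d.Gam m x (d.e a x) * d.Gam l x (d.e b x))) := by
  have hd (a b c c' : Fin 3) : mvfderiv (𝓡 3)
        (fun y ↦ d.coframe c' y (d.nabla (d.e c) y (d.e b y))) x (d.e a x)
      = ∑ n, eps n c c' * mvfderiv (𝓡 3) (fun y ↦ d.Gam n y (d.e b y)) x (d.e a x) := by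
    simp only [d.coframe_nabla_e]
    rw [mvfderiv_sum (f := fun n y ↦ eps n c c' * d.Gam n y (d.e b y)) fun n ↦
      (d.mdifferentiableAt_Gam n b).const_smul (eps n c c')]
    simp only [_root_.sum_apply]
    refine Finset.sum_congr rfl fun n _ ↦ ?_
    exact congrArg (fun L ↦ L (d.e a x)) (mvfderiv_const_mul (eps n c c') (d.mdifferentiableAt_Gam n b))
  -- The bracket term of the curvature is absorbed into dΓ; the products of first derivatives,
  -- expanded in the frame, will supply ½[Γ ∧ Γ].
  have hR (a b : Fin 3) : q.inner x (curvature d.nabla (d.e a) (d.e b) (d.e a) x) (d.e b x)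
      = ∑ n, eps n a b * (d.extD (d.Gam n) x ![d.e a x, d.e b x])
        - ∑ m, ((∑ c, eps c a m * d.Gam c x (d.e b x)) * (∑ c, eps c b m * d.Gam c x (d.e a x))
          - (∑ c, eps c a m * d.Gam c x (d.e a x)) * (∑ c, eps c b m * d.Gam c x (d.e b x))) := by
    have h := (toPseudo q).inner_curvature isOpen_univ (d.contMDiff a).contMDiffOn
      (d.contMDiff b).contMDiffOn (d.contMDiff a).contMDiffOn (d.mdifferentiableAt_e b)
      (Set.mem_univ x)
    simp only [fun y v ↦ (toPseudo q).symm y v (d.e b y)] at h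
    change q.inner x (d.e b x) (curvature d.nabla (d.e a) (d.e b) (d.e a) x)
      = mvfderiv (𝓡 3) (fun y ↦ d.coframe b y (d.nabla (d.e a) y (d.e b y))) x (d.e a x)
        - q.inner x (d.nabla (d.e a) x (d.e b x)) (d.nabla (d.e b) x (d.e a x))
        - (mvfderiv (𝓡 3) (fun y ↦ d.coframe b y (d.nabla (d.e a) y (d.e a y))) x (d.e b x)
          - q.inner x (d.nabla (d.e a) x (d.e a x)) (d.nabla (d.e b) x (d.e b x)))
        - d.coframe b x (d.nabla (d.e a) x (mlieBracket (𝓡 3) (d.e a) (d.e b) x)) at h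
    rw [q.symm, h, hd, hd, d.inner_eq_sum, d.inner_eq_sum]
    simp only [d.coframe_nabla_e, d.extD_e, mul_sub, Finset.sum_sub_distrib]
    ring
  simp only [scalR, hR]
  simp [Fin.sum_univ_three, eps]
  ring

/-- The components of the reduced curvature `R - ½ [K ∧ K]`. -/
lemma fieldStrength_Gam_sub_bracket_e (β : ℝ) (A : Fin 3 → OneForm M) (b c : Fin 3) :
    (d.fieldStrength d.Gam x - (1 / 2 : ℝ) • d.bracket (d.K β A) (d.K β A) x)
      ![d.e b x, d.e c x] = ∑ a, (d.extD (d.Gam a) x ![d.e b x, d.e c x]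
    + ∑ m, ∑ n, eps a m n * (d.Gam m x (d.e b x) * d.Gam n x (d.e c x))
    + -(1 / 2) * ∑ m, ∑ n, eps a m n * (d.K β A m x (d.e b x) * d.K β A n x (d.e c x)
        - d.K β A m x (d.e c x) * d.K β A n x (d.e b x))) • tau a := by
  rw [AlternatingMap.sub_apply, AlternatingMap.smul_apply, sub_eq_add_neg, ← neg_smul]
  simp only [ fieldStrength_apply,
    bracket_apply, Finset.smul_sum, smul_smul, ← Finset.sum_add_distrib, ← add_smul]
  rfl

/-- The R-part is `scalR_eq`. For the quadratic part, ε_abc ε_amn = δ_bm δ_cn - δ_bn δ_cm turns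
-½[K̊ ∧ K̊] into tr W² - (tr W)². Symmetry of W plays no role here. -/
lemma trStarWedge_eq_gaussExpr (β : ℝ) (A : Fin 3 → OneForm M) :
    d.trStarWedge (d.fieldStrength d.Gam x - (1 / 2 : ℝ) • d.bracket (d.K β A) (d.K β A) x)
      = (-(1 / 2) * d.gaussExpr β A x) • d.vol x := by
  rw [d.trStarWedge_eq (d.fieldStrength_Gam_sub_bracket_e β A), gaussExpr, d.scalR_eq, d.trace_W,
    d.trace_W_comp_W, sum_eps_mul_add, add_sub_assoc]
  congr 3
  simp [Fin.sum_univ_three, eps]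
  ring

/-- The weight ½(β² + 1) is tuned so that β²/2 cancels and -½[K̊ ∧ K̊] remains. The leftover β(dK̊ +
[Γ ∧ K̊]) is invisible to the ε-contraction when W is symmetric. Symmetry is required at all points,
since K̊ is differentiated. -/
theorem scalarConstraint_eq {A : Fin 3 → OneForm M} (hA : ∀ a, (A a).Smooth) {β : ℝ}
    (hβ : β ≠ 0) (hG : ∀ a y, d.gauss A a y = 0) (x : M) :
    d.scalarConstraint β A x = d.trStarWedge
      (d.fieldStrength d.Gam x - (1 / 2 : ℝ) • d.bracket (d.K β A) (d.K β A) x) := by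
  have hK := d.sum_eps_covariantD_K (x := x) (κ := d.K β A) fun a b y ↦
    d.K_symm_of_gauss hβ (hG · y) a b
  have h1 : d.fieldStrength A x - (1 / 2 * (β ^ 2 + 1)) • d.bracket (d.K β A) (d.K β A) x
      = (d.fieldStrength d.Gam x - (1 / 2 : ℝ) • d.bracket (d.K β A) (d.K β A) x)
        + β • (d.dForm (d.K β A) x + d.bracket d.Gam (d.K β A) x) := by
    rw [d.fieldStrength_eq hA hβ]
    module
  let k (a b c : Fin 3) : ℝ := d.extD (d.K β A a) x ![d.e b x, d.e c x]
      + ∑ m, ∑ n, eps a m n * (d.Gam m x (d.e b x) * d.K β A n x (d.e c x)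
        - d.Gam m x (d.e c x) * d.K β A n x (d.e b x))
  have hk (b c : Fin 3) : (d.dForm (d.K β A) x + d.bracket d.Gam (d.K β A) x)
      ![d.e b x, d.e c x] = ∑ a, k a b c • tau a := by
    simp only [AlternatingMap.add_apply, dForm, su2Two_apply, bracket_apply,
      ← Finset.sum_add_distrib, ← add_smul]
    rfl
  obtain ⟨r, hr⟩ : ∃ r : Fin 3 → Fin 3 → Fin 3 → ℝ, ∀ b c, (d.fieldStrength d.Gam x
      - (1 / 2 : ℝ) • d.bracket (d.K β A) (d.K β A) x) ![d.e b x, d.e c x] = ∑ a, r a b c • tau a :=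
    ⟨_, d.fieldStrength_Gam_sub_bracket_e β A⟩
  rw [scalarConstraint, h1, d.trStarWedge_eq hr,
    d.trStarWedge_eq (h := fun a b c ↦ r a b c + β * k a b c)]
  · rw [sum_eps_mul_add, hK, mul_zero, add_zero]
  · intro b c
    rw [AlternatingMap.add_apply, AlternatingMap.smul_apply, hr, hk, Finset.smul_sum,
      ← Finset.sum_add_distrib]
    simp only [smul_smul, ← add_smul]

theorem scalarConstraint_eq_smul_vol {A : Fin 3 → OneForm M} (hA : ∀ a, (A a).Smooth) {β : ℝ}
    (hβ : β ≠ 0) (hG : ∀ a y, d.gauss A a y = 0) (x : M) :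
    d.scalarConstraint β A x = (-(1 / 2) * d.gaussExpr β A x) • d.vol x := by
  rw [d.scalarConstraint_eq hA hβ hG, d.trStarWedge_eq_gaussExpr]

theorem scalarConstraint_eq_zero_iff {A : Fin 3 → OneForm M} (hA : ∀ a, (A a).Smooth) {β : ℝ}
    (hβ : β ≠ 0) (hG : ∀ a y, d.gauss A a y = 0) (x : M) :
    d.scalarConstraint β A x = 0 ↔ d.gaussExpr β A x = 0 := by
  rw [d.scalarConstraint_eq_smul_vol hA hβ hG, smul_eq_zero, or_iff_left d.vol_ne_zero]
  norm_num

/-- Relabel the summation indices and exchange the first two arguments of the curvature. -/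
lemma scalarCurvature_eq : d.scalarCurvature x = - d.scalR x := by
  rw [scalarCurvature, scalR, Finset.sum_comm, ← Finset.sum_neg_distrib]
  refine Finset.sum_congr rfl fun a _ ↦ ?_
  rw [← Finset.sum_neg_distrib]
  refine Finset.sum_congr rfl fun b _ ↦ ?_
  rw [curvature_swap, map_neg, neg_apply]

end Dreibein

end GaugeTheory

/-! ### Coordinate expressions in a chart. -/

section Charts

variable {M : Type*} [TopologicalSpace M] [ChartedSpace (EuclideanSpace ℝ (Fin 3)) M]
  [IsManifold (𝓡 3) ∞ M]

lemma mdifferentiable_of_mem_maximalAtlas {E : Type*} [NormedAddCommGroup E] [NormedSpace ℝ E]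
    {M : Type*} [TopologicalSpace M] [ChartedSpace E M] {φ : OpenPartialHomeomorph M E}
    (hφ : φ ∈ IsManifold.maximalAtlas 𝓘(ℝ, E) ∞ M) :
    φ.MDifferentiable 𝓘(ℝ, E) 𝓘(ℝ, E) :=
  ⟨(contMDiffOn_of_mem_maximalAtlas hφ).mdifferentiableOn (by simp),
    (contMDiffOn_symm_of_mem_maximalAtlas hφ).mdifferentiableOn (by simp)⟩

namespace Dreibein

variable {q : Metric M} (d : Dreibein q)
  {φ : OpenPartialHomeomorph M (EuclideanSpace ℝ (Fin 3))} {y : EuclideanSpace ℝ (Fin 3)}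

lemma sum_dx_smul_partialVec (hφ : φ ∈ IsManifold.maximalAtlas (𝓡 3) ∞ M) (hy : y ∈ φ.target)
    (v : TangentSpace (𝓡 3) (φ.symm y)) :
    ∑ i, d.dx φ i (φ.symm y) v • d.partialVec φ i y = v := by
  have h := (mdifferentiable_of_mem_maximalAtlas hφ).symm_comp_deriv (φ.map_target hy)
  have h2 := congrArg (fun L ↦ L v) h
  rw [φ.right_inv hy] at h2
  have h3 (w : EuclideanSpace ℝ (Fin 3)) :
      ∑ i, w i • (EuclideanSpace.single i (1 : ℝ) : EuclideanSpace ℝ (Fin 3)) = w := by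
    ext j
    simp [Pi.single_apply]
  have h4 (L : EuclideanSpace ℝ (Fin 3) →L[ℝ] EuclideanSpace ℝ (Fin 3))
      (w : EuclideanSpace ℝ (Fin 3)) : ∑ i, w i • L (EuclideanSpace.single i (1 : ℝ)) = L w := by
    conv_rhs => rw [← h3 w, map_sum]
    simp only [map_smul]
  exact (h4 (mfderiv (𝓡 3) (𝓡 3) φ.symm y) (mfderiv (𝓡 3) (𝓡 3) φ (φ.symm y) v)).trans h2

/-- The components `e_i^a = e^a(∂_i)`, with row index `i` and column index `a`. -/
def coframeMatrix (φ : OpenPartialHomeomorph M (EuclideanSpace ℝ (Fin 3)))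
    (y : EuclideanSpace ℝ (Fin 3)) : Matrix (Fin 3) (Fin 3) ℝ :=
  Matrix.of fun i a ↦ d.coframe a (φ.symm y) (d.partialVec φ i y)

lemma eUp_mul_coframeMatrix (hφ : φ ∈ IsManifold.maximalAtlas (𝓡 3) ∞ M) (hy : y ∈ φ.target) :
    (d.eUp φ y).transpose * d.coframeMatrix φ y = 1 := by
  ext a b
  have h := congrArg (d.coframe b (φ.symm y)) (d.sum_dx_smul_partialVec hφ hy (d.e a (φ.symm y)))
  rw [d.coframe_e, map_sum] at h
  simp only [map_smul, smul_eq_mul] at h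
  simp only [Matrix.mul_apply, Matrix.one_apply, Matrix.transpose_apply, eUp, coframeMatrix,
    Matrix.of_apply, h]
  simp [eq_comm]

lemma det_eUp_mul_det_coframeMatrix (hφ : φ ∈ IsManifold.maximalAtlas (𝓡 3) ∞ M)
    (hy : y ∈ φ.target) : (d.eUp φ y).det * (d.coframeMatrix φ y).det = 1 := by
  rw [← Matrix.det_transpose (d.eUp φ y), ← Matrix.det_mul, d.eUp_mul_coframeMatrix hφ hy,
    Matrix.det_one]

lemma qDown_eq : d.qDown φ y = d.coframeMatrix φ y * (d.coframeMatrix φ y).transpose := by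
  ext i j
  simp [qDown, d.inner_eq_sum, Matrix.mul_apply, coframeMatrix]

lemma det_qDown : (d.qDown φ y).det = (d.coframeMatrix φ y).det ^ 2 := by
  rw [qDown_eq, Matrix.det_mul, Matrix.det_transpose, sq]

lemma sqrtq_eq : d.sqrtq φ y = |(d.coframeMatrix φ y).det| := by
  rw [sqrtq, det_qDown, Real.sqrt_sq_eq_abs]

/-- The factor is the signed determinant of e^a(∂_i), so this is valid for either orientation of the
chart; it equals √q only when that determinant is positive. -/
lemma vol_eq (hφ : φ ∈ IsManifold.maximalAtlas (𝓡 3) ∞ M) (hy : y ∈ φ.target) :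
    d.vol (φ.symm y) = (d.coframeMatrix φ y).det • d.dx₁₂₃ φ (φ.symm y) := by
  ext u
  have : (Matrix.of fun i a ↦ d.coframe a (φ.symm y) (u i))
      = (Matrix.of fun i k ↦ d.dx φ k (φ.symm y) (u i)) * d.coframeMatrix φ y := by
    ext i a
    rw [Matrix.of_apply]
    conv_lhs => rw [← d.sum_dx_smul_partialVec hφ hy (u i)]
    simp [Matrix.mul_apply, coframeMatrix]
  rw [d.vol_apply, this, Matrix.det_mul, mul_comm]
  rfl

lemma apply_eq_sum_comp (hφ : φ ∈ IsManifold.maximalAtlas (𝓡 3) ∞ M) (α : OneForm M) {x : M}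
    (hx : x ∈ φ.source) (v : TangentSpace (𝓡 3) x) :
    α x v = ∑ k, d.comp φ α k (φ x) * d.dx φ k x v := by
  obtain ⟨y, hy, rfl⟩ : ∃ y ∈ φ.target, φ.symm y = x := ⟨φ x, φ.map_source hx, φ.left_inv hx⟩
  rw [φ.right_inv hy]
  conv_lhs => rw [← d.sum_dx_smul_partialVec hφ hy v]
  simp [comp, mul_comm]

omit [IsManifold (𝓡 3) ∞ M] in
lemma contMDiffAt_coord (hφ : φ ∈ IsManifold.maximalAtlas (𝓡 3) ∞ M) {x : M} (hx : x ∈ φ.source)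
    (k : Fin 3) : ContMDiffAt (𝓡 3) 𝓘(ℝ, ℝ) ∞ (fun z ↦ φ z k) x :=
  (EuclideanSpace.proj k : EuclideanSpace ℝ (Fin 3) →L[ℝ] ℝ).contMDiff.contMDiffAt.comp x
    (contMDiffAt_of_mem_maximalAtlas hφ hx)

lemma mvfderiv_coord (hφ : φ ∈ IsManifold.maximalAtlas (𝓡 3) ∞ M) {x : M} (hx : x ∈ φ.source)
    (k : Fin 3) (v : TangentSpace (𝓡 3) x) :
    mvfderiv (𝓡 3) (fun z ↦ φ z k) x v = d.dx φ k x v := by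
  have h := mvfderiv_comp_apply x (I := 𝓡 3) (I' := 𝓡 3)
    (g := (EuclideanSpace.proj k : EuclideanSpace ℝ (Fin 3) →L[ℝ] ℝ)) (f := φ)
    ((EuclideanSpace.proj k : EuclideanSpace ℝ (Fin 3) →L[ℝ] ℝ).contMDiff.mdifferentiable
      (n := 1) (by simp) _)
    ((mdifferentiable_of_mem_maximalAtlas hφ).mdifferentiableAt hx) v
  simp only [mvfderiv, mfderiv_eq_fderiv, ContinuousLinearMap.fderiv] at h
  exact h

/-- The exterior derivative in a chart. -/
lemma extD_e_eq_sum (hφ : φ ∈ IsManifold.maximalAtlas (𝓡 3) ∞ M) (hy : y ∈ φ.target)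
    {α : OneForm M}
    (hα : ∀ b, MDifferentiableAt (𝓡 3) 𝓘(ℝ, ℝ) (fun z ↦ α z (d.e b z)) (φ.symm y)) (a b : Fin 3) :
    d.extD α (φ.symm y) ![d.e a (φ.symm y), d.e b (φ.symm y)]
      = ∑ i, ∑ j, (d.dcomp φ α i j y - d.dcomp φ α j i y)
        * (d.eUp φ y i a * d.eUp φ y j b) := by
  set x := φ.symm y with hx
  have hxs : x ∈ φ.source := φ.map_target hy
  have hsrc := φ.open_source.mem_nhds hxs
  let c (k : Fin 3) (z : M) : ℝ := d.comp φ α k (φ z)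
  let U (k b : Fin 3) (z : M) : ℝ := d.dx φ k z (d.e b z)
  have hU (k b) {z} (hz : z ∈ φ.source) : ContMDiffAt (𝓡 3) 𝓘(ℝ, ℝ) ∞ (U k b) z := by
    refine (contMDiffAt_mvfderiv (contMDiffAt_coord hφ hz k) (d.contMDiff b z)).congr_of_eventuallyEq
      ?_
    filter_upwards [φ.open_source.mem_nhds hz] with z hz
    exact (d.mvfderiv_coord hφ hz k _).symm
  have hUd (k b) : MDifferentiableAt (𝓡 3) 𝓘(ℝ, ℝ) (U k b) x :=
    (hU k b hxs).mdifferentiableAt (by simp)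
  have hαc {z} (hz : z ∈ φ.source) (b) : α z (d.e b z) = ∑ k, c k z * U k b z :=
    d.apply_eq_sum_comp hφ α hz _
  have hdet {z} (hz : z ∈ φ.source) : (Matrix.of fun k b ↦ U k b z).det ≠ 0 := by
    have h := d.det_eUp_mul_det_coframeMatrix hφ (φ.map_source hz)
    have h2 : d.eUp φ (φ z) = Matrix.of fun k b ↦ U k b z := by
      rw [eUp, φ.left_inv hz]
    rw [h2] at h
    exact left_ne_zero_of_mul_eq_one h
  -- Differentiability is known for the frame components only; the coordinate components follow by
  -- inverting the smooth matrix e^k_b.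
  have hc (k) : MDifferentiableAt (𝓡 3) 𝓘(ℝ, ℝ) (c k) x := by
    have h : c k =ᶠ[𝓝 x] fun z ↦ ∑ b, α z (d.e b z) * (Matrix.of fun k b ↦ U k b z)⁻¹ b k := by
      filter_upwards [hsrc] with z hz
      have h1 : (fun b ↦ α z (d.e b z)) = Matrix.vecMul (c · z) (Matrix.of fun k b ↦ U k b z) := by
        ext b; simpa [Matrix.vecMul, dotProduct] using hαc hz b
      have h2 : Matrix.vecMul (fun b ↦ α z (d.e b z)) (Matrix.of fun k b ↦ U k b z)⁻¹ = (c · z) := by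
        rw [h1, Matrix.vecMul_vecMul, Matrix.mul_nonsing_inv _ (hdet hz).isUnit, Matrix.vecMul_one]
      exact (congrFun h2 k).symm
    refine MDifferentiableAt.congr_of_eventuallyEq ?_ h
    exact mdifferentiableAt_sum fun b ↦ (hα b).mul
      ((contMDiffAt_matrix_inv (G := fun z ↦ Matrix.of fun k b ↦ U k b z)
        (fun k b ↦ hU k b hxs) (hdet hxs) b k).mdifferentiableAt (by simp))
  have hdc (i k) : mvfderiv (𝓡 3) (c k) x (d.partialVec φ i y) = d.dcomp φ α i k y := by
    have h := mvfderiv_comp_apply y (I := 𝓡 3) (I' := 𝓡 3) (g := c k) (f := φ.symm) (hc k)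
      ((mdifferentiable_of_mem_maximalAtlas hφ).symm.mdifferentiableAt hy)
      (EuclideanSpace.single i (1 : ℝ))
    refine h.symm.trans ?_
    rw [mvfderiv, mfderiv_eq_fderiv]
    have he : c k ∘ φ.symm =ᶠ[𝓝 y] d.comp φ α k := by
      filter_upwards [φ.open_target.mem_nhds hy] with w hw
      simp [c, φ.right_inv hw]
    rw [he.fderiv_eq]
    rfl
  have hec (a k) : mvfderiv (𝓡 3) (c k) x (d.e a x) = ∑ i, U i a x * d.dcomp φ α i k y := by
    conv_lhs => rw [← d.sum_dx_smul_partialVec hφ hy (d.e a x)]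
    rw [map_sum]
    refine Finset.sum_congr rfl fun i _ ↦ ?_
    rw [map_smul, hdc]
    rfl
  -- The commutator formula applied to the k-th coordinate function.
  have hbr (k) : d.dx φ k x (mlieBracket (𝓡 3) (d.e a) (d.e b) x)
      = mvfderiv (𝓡 3) (U k b) x (d.e a x) - mvfderiv (𝓡 3) (U k a) x (d.e b x) := by
    have hd (b) : (fun z ↦ mvfderiv (𝓡 3) (fun z ↦ φ z k) z (d.e b z)) =ᶠ[𝓝 x] U k b := by
      filter_upwards [hsrc] with z hz
      exact d.mvfderiv_coord hφ hz k _
    have h := mvfderiv_mlieBracket (contMDiffAt_coord hφ hxs k) (d.mdifferentiableAt_e (x := x) a)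
      (d.mdifferentiableAt_e b) ((hUd k a).congr_of_eventuallyEq (hd a))
      ((hUd k b).congr_of_eventuallyEq (hd b))
    rw [mvfderiv_congr (hd a), mvfderiv_congr (hd b), d.mvfderiv_coord hφ hxs] at h
    exact h
  have hd (a b) : mvfderiv (𝓡 3) (fun z ↦ α z (d.e b z)) x (d.e a x)
      = ∑ k, (c k x * mvfderiv (𝓡 3) (U k b) x (d.e a x)
        + U k b x * ∑ i, U i a x * d.dcomp φ α i k y) := by
    have h : (fun z ↦ α z (d.e b z)) =ᶠ[𝓝 x] fun z ↦ ∑ k, c k z * U k b z := by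
      filter_upwards [hsrc] with z hz using hαc hz b
    rw [mvfderiv_congr h, mvfderiv_sum (f := fun k z ↦ c k z * U k b z)
      fun k ↦ (hc k).mul (hUd k b), _root_.sum_apply]
    refine Finset.sum_congr rfl fun k _ ↦ ?_
    have h2 := congrArg (fun L ↦ L (d.e a x)) (mvfderiv_mul (hc k) (hUd k b))
    refine h2.trans ?_
    rw [← hec]
    rfl
  rw [d.extD_e, hd, hd, d.apply_eq_sum_comp hφ α hxs]
  -- The derivatives of e^k_a from the product rule now cancel against those in the bracket term.
  simp only [hbr]
  change _ = ∑ i, ∑ j, (d.dcomp φ α i j y - d.dcomp φ α j i y) * (U i a x * U j b x)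
  simp only [Fin.sum_univ_three]
  ring

/-- The curvature components are tensorial, so two factors e^i_b pass from chart to frame. Positive
orientation identifies √q with the determinant relating the two volume forms. -/
theorem scalarConstraint_chart {A : Fin 3 → OneForm M} (hA : ∀ a, (A a).Smooth) (β : ℝ)
    (hφ : φ ∈ IsManifold.maximalAtlas (𝓡 3) ∞ M) (hy : y ∈ φ.target) (hpos : 0 < (d.eUp φ y).det) :
    d.scalarConstraint β A (φ.symm y)
      = (-(1 / 2) * d.scalarCoord φ β A y) • d.dx₁₂₃ φ (φ.symm y) := by
  have hdet := d.det_eUp_mul_det_coframeMatrix hφ hy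
  set D := (d.coframeMatrix φ y).det with hD
  have hDpos : 0 < D := by
    by_contra h
    nlinarith
  have hs : d.sqrtq φ y = D := by rw [sqrtq_eq, ← hD, abs_of_pos hDpos]
  -- With √q = D and det(e^i_a) = 1/D, the densitized determinant is D³/D = D².
  have hE : √((d.EUp φ y).det) = D := by
    rw [EUp, Matrix.det_smul, hs, Fintype.card_fin]
    have : D ^ 3 * (d.eUp φ y).det = D ^ 2 := by linear_combination D ^ 2 * hdet
    rw [this, Real.sqrt_sq hDpos.le]
  set x := φ.symm y with hx
  have hxs : x ∈ φ.source := φ.map_target hy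
  have hcomp (α : OneForm M) (a) : α x (d.e a x) = ∑ i, d.comp φ α i y * d.eUp φ y i a := by
    have h := d.apply_eq_sum_comp hφ α hxs (d.e a x)
    rw [hx, φ.right_inv hy] at h
    exact h
  let h (a i j : Fin 3) : ℝ := d.Fcomp φ A a i j y - (β ^ 2 + 1) *
        ∑ b, ∑ c, eps a b c * d.comp φ (d.K β A b) i y * d.comp φ (d.K β A c) j y
  have hprod (α γ : OneForm M) (b c) : α x (d.e b x) * γ x (d.e c x)
      = ∑ i, ∑ j, (d.comp φ α i y * d.comp φ γ j y) * (d.eUp φ y i b * d.eUp φ y j c) := by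
    rw [hcomp, hcomp, Finset.sum_mul_sum]
    exact Finset.sum_congr rfl fun i _ ↦ Finset.sum_congr rfl fun j _ ↦ by ring
  have hη (b c : Fin 3) : (d.fieldStrength A x
      - (1 / 2 * (β ^ 2 + 1)) • d.bracket (d.K β A) (d.K β A) x) ![d.e b x, d.e c x]
      = ∑ a, (∑ i, ∑ j, h a i j * (d.eUp φ y i b * d.eUp φ y j c)) • tau a := by
    rw [AlternatingMap.sub_apply, AlternatingMap.smul_apply, sub_eq_add_neg, ← neg_smul]
    simp only [fieldStrength_apply, bracket_apply, Finset.smul_sum, smul_smul,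
      ← Finset.sum_add_distrib, ← add_smul]
    refine Finset.sum_congr rfl fun a _ ↦ ?_
    congr 1
    rw [d.extD_e_eq_sum hφ hy (d.mdifferentiableAt_smooth (hA a))]
    simp only [Matrix.cons_val_zero, Matrix.cons_val_one]
    simp only [fun m n ↦ hprod (A m) (A n) b c, fun m n ↦ hprod (d.K β A m) (d.K β A n) b c,
      fun m n ↦ hprod (d.K β A m) (d.K β A n) c b, h, Fcomp]
    generalize d.eUp φ y = u
    fin_cases a <;> simp [Fin.sum_univ_three, eps] <;> ring
  rw [scalarConstraint, d.trStarWedge_eq hη, hx, d.vol_eq hφ hy, smul_smul, ← hD]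
  congr 1
  rw [mul_assoc]
  congr 1
  -- The two densitized factors contribute D² and the denominator D; the remaining D is the factor
  -- in `vol_eq`.
  have hterm (a i j b' c') : h a i j * (eps a b' c' * d.EUp φ y i b' * d.EUp φ y j c')
      / √((d.EUp φ y).det) = D * (eps a b' c' * (h a i j * (d.eUp φ y i b' * d.eUp φ y j c'))) := by
    rw [hE, EUp, hs]
    simp only [Matrix.smul_apply, smul_eq_mul]
    field_simp
  change _ = ∑ a, ∑ i, ∑ j, ∑ b', ∑ c', h a i j
      * (eps a b' c' * d.EUp φ y i b' * d.EUp φ y j c') / √((d.EUp φ y).det)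
  simp only [hterm, ← Finset.mul_sum]
  rw [mul_comm]
  congr 1
  refine Finset.sum_congr rfl fun a _ ↦ ?_
  simp only [Finset.mul_sum]
  simp only [Fin.sum_univ_three]
  ring

end Dreibein

end Charts

/-! ### The superhamiltonian. -/

section SuperHamiltonian

variable {M : Type*} [TopologicalSpace M] [ChartedSpace (EuclideanSpace ℝ (Fin 3)) M]
  [IsManifold (𝓡 3) ∞ M]

/-- The DeWitt quadratic form in matrix notation. -/
lemma sum_deWitt_eq_trace {n : Type*} [Fintype n] {G p : Matrix n n ℝ} (hG : G.transpose = G)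
    (hp : p.transpose = p) :
    ∑ i, ∑ j, ∑ m, ∑ l, (G i m * G j l - 1 / 2 * G i j * G m l) * p i j * p m l
      = (G * p * (G * p)).trace - 1 / 2 * (G * p).trace ^ 2 := by
  have hG' (i j) : G i j = G j i := congrFun (congrFun hG j) i
  have hp' (i j) : p i j = p j i := congrFun (congrFun hp j) i
  have h1 : (G * p * (G * p)).trace = ∑ i, ∑ j, ∑ m, ∑ l, G i m * G j l * p i j * p m l := by
    have : (G * p * (G * p)).trace = ∑ m, ∑ j, ∑ i, ∑ l, G i m * G j l * p i j * p m l := by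
      simp only [Matrix.trace, Matrix.diag_apply, Matrix.mul_apply, Finset.sum_mul_sum]
      refine Finset.sum_congr rfl fun m _ ↦ Finset.sum_congr rfl fun j _ ↦
        Finset.sum_congr rfl fun i _ ↦ Finset.sum_congr rfl fun l _ ↦ ?_
      rw [hG' m i, hp' l m]
      ring
    rw [this, Finset.sum_comm]
    conv_rhs => rw [Finset.sum_comm]
    refine Finset.sum_congr rfl fun j _ ↦ ?_
    rw [Finset.sum_comm]
  have h2 : (G * p).trace ^ 2 = ∑ i, ∑ j, ∑ m, ∑ l, G i j * G m l * p i j * p m l := by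
    have : (G * p).trace = ∑ i, ∑ j, G i j * p i j := by
      simp only [Matrix.trace, Matrix.diag_apply, Matrix.mul_apply]
      exact Finset.sum_congr rfl fun i _ ↦ Finset.sum_congr rfl fun j _ ↦ by rw [hp' j i]
    rw [this, sq, Finset.sum_mul]
    refine Finset.sum_congr rfl fun i _ ↦ ?_
    rw [Finset.sum_mul]
    refine Finset.sum_congr rfl fun j _ ↦ ?_
    rw [Finset.mul_sum]
    refine Finset.sum_congr rfl fun m _ ↦ ?_
    rw [Finset.mul_sum]
    exact Finset.sum_congr rfl fun l _ ↦ by ring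
  rw [h1, h2, Finset.mul_sum, ← Finset.sum_sub_distrib]
  refine Finset.sum_congr rfl fun i _ ↦ ?_
  rw [Finset.mul_sum, ← Finset.sum_sub_distrib]
  refine Finset.sum_congr rfl fun j _ ↦ ?_
  rw [Finset.mul_sum, ← Finset.sum_sub_distrib]
  refine Finset.sum_congr rfl fun m _ ↦ ?_
  rw [Finset.mul_sum, ← Finset.sum_sub_distrib]
  exact Finset.sum_congr rfl fun l _ ↦ by ring

namespace Dreibein

variable {q : Metric M} (d : Dreibein q)
  {φ : OpenPartialHomeomorph M (EuclideanSpace ℝ (Fin 3))} {y : EuclideanSpace ℝ (Fin 3)}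

lemma KDown_eq (β : ℝ) (A : Fin 3 → OneForm M) : d.KDown φ β A y = d.coframeMatrix φ y
    * (Matrix.of fun b a ↦ d.K β A a (φ.symm y) (d.e b (φ.symm y)))
    * (d.coframeMatrix φ y).transpose := by
  ext i j
  have h1 : d.KDown φ β A y i j = ∑ a, d.K β A a (φ.symm y) (d.partialVec φ i y)
      * d.coframe a (φ.symm y) (d.partialVec φ j y) := by
    simp [KDown, W, LinearMap.sum_apply, _root_.sum_apply, coframe]
  rw [h1, Matrix.mul_apply]
  refine Finset.sum_congr rfl fun a _ ↦ ?_
  rw [d.apply_eq_sum (d.K β A a), Matrix.mul_apply]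
  rfl

/-- The matrix P of e^a(∂_i) satisfies q = P Pᵀ, so the traces can be computed in the dreibein. The
Gauss constraint enters as symmetry of κ, which makes the momenta symmetric as the trace form of the
DeWitt expression requires. -/
theorem superHamiltonian_eq {A : Fin 3 → OneForm M} {β : ℝ} (hβ : β ≠ 0)
    (hG : ∀ a x, d.gauss A a x = 0) (hφ : φ ∈ IsManifold.maximalAtlas (𝓡 3) ∞ M)
    (hy : y ∈ φ.target) {k : ℝ} (hk : k ≠ 0) :
    d.superHamiltonian φ k β A y = d.sqrtq φ y / k * d.gaussExpr β A (φ.symm y) := by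
  set P := d.coframeMatrix φ y with hP
  set κ : Matrix (Fin 3) (Fin 3) ℝ :=
    Matrix.of fun b a ↦ d.K β A a (φ.symm y) (d.e b (φ.symm y)) with hκ
  have hκs : κ.transpose = κ := by
    ext a b
    exact d.K_symm_of_gauss hβ (hG · _) a b
  set Q := (d.eUp φ y).transpose with hQ
  have hQP : Q * P = 1 := d.eUp_mul_coframeMatrix hφ hy
  have hPQ : P * Q = 1 := mul_eq_one_comm.1 hQP
  have hPQt : Q.transpose * P.transpose = 1 := by rw [← Matrix.transpose_mul, hPQ, Matrix.transpose_one]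
  have hQPt : P.transpose * Q.transpose = 1 := by rw [← Matrix.transpose_mul, hQP, Matrix.transpose_one]
  have hinv : (d.qDown φ y)⁻¹ = Q.transpose * Q := by
    refine Matrix.inv_eq_right_inv ?_
    rw [d.qDown_eq, ← hP, Matrix.mul_assoc, ← Matrix.mul_assoc P.transpose, hQPt, Matrix.one_mul, hPQ]
  have hKD : d.KDown φ β A y = P * κ * P.transpose := d.KDown_eq β A
  have hqK : (d.qDown φ y)⁻¹ * d.KDown φ β A y = Q.transpose * (κ * P.transpose) := by
    rw [hinv, hKD, Matrix.mul_assoc P, Matrix.mul_assoc, ← Matrix.mul_assoc Q, hQP, Matrix.one_mul]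
  have htr : ((d.qDown φ y)⁻¹ * d.KDown φ β A y).trace = κ.trace := by
    rw [hqK, Matrix.trace_mul_comm, Matrix.mul_assoc, hQPt, Matrix.mul_one]
  set s := d.sqrtq φ y with hs
  have hs0 : s ≠ 0 := by
    rw [hs, sqrtq_eq]
    exact abs_ne_zero.2 (right_ne_zero_of_mul_eq_one (d.det_eUp_mul_det_coframeMatrix hφ hy))
  -- The momenta in the dreibein, up to the factor s/k. In dimension 3, tr B = -2 tr κ and tr B² =
  -- tr κ² + (tr κ)², so tr B² - ½(tr B)² = tr κ² - (tr κ)².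
  set B := κ - κ.trace • (1 : Matrix (Fin 3) (Fin 3) ℝ) with hB
  have hp : d.PUp φ k β A y = (s / k) • (Q.transpose * B * Q) := by
    rw [PUp, htr, hqK, hinv, hB, Matrix.mul_sub, Matrix.sub_mul, Matrix.mul_smul, Matrix.mul_one,
      Matrix.smul_mul]
    congr 2
    rw [Matrix.mul_assoc, Matrix.mul_assoc κ, ← Matrix.mul_assoc P.transpose, hQPt, Matrix.one_mul,
      Matrix.mul_assoc]
  have hBt : B.transpose = B := by
    rw [hB, Matrix.transpose_sub, hκs, Matrix.transpose_smul, Matrix.transpose_one]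
  have hpt : (d.PUp φ k β A y).transpose = d.PUp φ k β A y := by
    rw [hp, Matrix.transpose_smul, Matrix.transpose_mul, Matrix.transpose_mul, hBt,
      Matrix.transpose_transpose, Matrix.mul_assoc]
  have hqt : (d.qDown φ y).transpose = d.qDown φ y := by
    rw [d.qDown_eq, Matrix.transpose_mul, Matrix.transpose_transpose]
  have hqp : d.qDown φ y * d.PUp φ k β A y = (s / k) • (P * B * Q) := by
    rw [hp, d.qDown_eq, ← hP, Matrix.mul_smul, Matrix.mul_assoc P, Matrix.mul_assoc Q.transpose,
      ← Matrix.mul_assoc P.transpose, hQPt, Matrix.one_mul, ← Matrix.mul_assoc P]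
  have ht1 : (P * B * Q).trace = B.trace := by
    rw [Matrix.mul_assoc, Matrix.trace_mul_comm, Matrix.mul_assoc, hQP, Matrix.mul_one]
  have ht2 : (P * B * Q * (P * B * Q)).trace = (B * B).trace := by
    have : P * B * Q * (P * B * Q) = P * (B * B) * Q := by
      rw [Matrix.mul_assoc (P * B), Matrix.mul_assoc P B Q, ← Matrix.mul_assoc Q, hQP,
        Matrix.one_mul, Matrix.mul_assoc P, Matrix.mul_assoc P, Matrix.mul_assoc B]
    rw [this, Matrix.mul_assoc, Matrix.trace_mul_comm, Matrix.mul_assoc, hQP, Matrix.mul_one]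
  have hB1 : B.trace = -2 * κ.trace := by
    rw [hB, Matrix.trace_sub, Matrix.trace_smul, Matrix.trace_one, Fintype.card_fin, smul_eq_mul]
    push_cast
    ring
  have hB2 : (B * B).trace = (κ * κ).trace + κ.trace ^ 2 := by
    have : B * B = κ * κ - (2 * κ.trace) • κ + (κ.trace ^ 2) • 1 := by
      rw [hB]
      simp only [Matrix.mul_sub, Matrix.sub_mul, Matrix.mul_smul, Matrix.smul_mul, Matrix.mul_one,
        Matrix.one_mul]
      module
    rw [this, Matrix.trace_add, Matrix.trace_sub, Matrix.trace_smul, Matrix.trace_smul,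
      Matrix.trace_one, Fintype.card_fin, smul_eq_mul, smul_eq_mul]
    push_cast
    ring
  have hg : d.gaussExpr β A (φ.symm y) = d.scalR (φ.symm y) + (κ * κ).trace - κ.trace ^ 2 := by
    rw [gaussExpr, trace_W, trace_W_comp_W]
    congr 2
  rw [superHamiltonian, sum_deWitt_eq_trace hqt hpt, hqp, hg, d.scalarCurvature_eq,
    Matrix.smul_mul, Matrix.mul_smul, Matrix.trace_smul, Matrix.trace_smul, Matrix.trace_smul, ht1,
    ht2, hB1, hB2, ← hs]
  simp only [smul_eq_mul]
  field_simp
  ring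

theorem scalarConstraint_eq_zero_iff_superHamiltonian {A : Fin 3 → OneForm M}
    (hA : ∀ a, (A a).Smooth) {β : ℝ} (hβ : β ≠ 0) (hG : ∀ a x, d.gauss A a x = 0)
    (hφ : φ ∈ IsManifold.maximalAtlas (𝓡 3) ∞ M) (hy : y ∈ φ.target) {k : ℝ} (hk : k ≠ 0) :
    d.scalarConstraint β A (φ.symm y) = 0 ↔ d.superHamiltonian φ k β A y = 0 := by
  have hs0 : d.sqrtq φ y ≠ 0 := by
    rw [sqrtq_eq]
    exact abs_ne_zero.2 (right_ne_zero_of_mul_eq_one (d.det_eUp_mul_det_coframeMatrix hφ hy))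
  rw [d.scalarConstraint_eq_zero_iff hA hβ hG, d.superHamiltonian_eq hβ hG hφ hy hk,
    mul_eq_zero_iff_left (div_ne_zero hs0 hk)]

end Dreibein

end SuperHamiltonian

/-! ### Vector fields along an immersion and their ambient extensions. -/

section Immersions

variable {E E' : Type*} [NormedAddCommGroup E] [NormedSpace ℝ E]
  [NormedAddCommGroup E'] [NormedSpace ℝ E']
  {M : Type*} [TopologicalSpace M] [ChartedSpace E M] [IsManifold 𝓘(ℝ, E) ∞ M]
  {N : Type*} [TopologicalSpace N] [ChartedSpace E' N] [IsManifold 𝓘(ℝ, E') ∞ N]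
  {ι : M → N} {x : M}

omit [IsManifold 𝓘(ℝ, E) ∞ M] [IsManifold 𝓘(ℝ, E') ∞ N] in
/-- An immersion has local smooth left inverses. -/
lemma exists_local_leftInverse (h : Manifold.IsImmersionAt 𝓘(ℝ, E) 𝓘(ℝ, E') ∞ ι x) :
    ∃ r : N → M, (∀ᶠ z in 𝓝 (ι x), ContMDiffAt 𝓘(ℝ, E') 𝓘(ℝ, E) ∞ r z) ∧
      ∀ᶠ y in 𝓝 x, r (ι y) = y := by
  -- In adapted charts the immersion is u ↦ (u, 0), so projection to the first factor is a left
  -- inverse.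
  let L : E' →L[ℝ] E := (ContinuousLinearMap.fst ℝ E h.complement).comp
    (h.equiv.symm : E' →L[ℝ] E × h.complement)
  have hL {y} (hy : y ∈ h.domChart.source) : L (h.codChart (ι y)) = h.domChart y := by
    have h1 := h.writtenInCharts (show h.domChart y ∈ (h.domChart.extend 𝓘(ℝ, E)).target by
      simpa using h.domChart.map_source hy)
    simp [h.domChart.left_inv hy] at h1
    simp [L, h1]
  refine ⟨fun z ↦ h.domChart.symm (L (h.codChart z)), ?_, ?_⟩
  · have hx := hL h.mem_domChart_source
    have hc : ContinuousAt (fun z ↦ L (h.codChart z)) (ι x) :=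
      L.continuous.continuousAt.comp (h.codChart.continuousAt h.mem_codChart_source)
    have ht : h.domChart.target ∈ 𝓝 (L (h.codChart (ι x))) := by
      rw [hx]
      exact h.domChart.open_target.mem_nhds (h.domChart.map_source h.mem_domChart_source)
    filter_upwards [hc ht, h.codChart.open_source.mem_nhds h.mem_codChart_source] with z hz hz'
    refine ContMDiffAt.comp z (contMDiffAt_symm_of_mem_maximalAtlas h.domChart_mem_maximalAtlas hz) ?_
    exact L.contMDiff.contMDiffAt.comp z
      (contMDiffAt_of_mem_maximalAtlas h.codChart_mem_maximalAtlas hz')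
  · filter_upwards [h.domChart.open_source.mem_nhds h.mem_domChart_source] with y hy
    rw [hL hy, h.domChart.left_inv hy]

/-- A vector field on an immersed submanifold extends locally to the ambient manifold. -/
lemma exists_extension (hι : ContMDiff 𝓘(ℝ, E) 𝓘(ℝ, E') ∞ ι)
    (h : Manifold.IsImmersionAt 𝓘(ℝ, E) 𝓘(ℝ, E') ∞ ι x)
    {X : Π y : M, TangentSpace 𝓘(ℝ, E) y}
    (hX : ContMDiff 𝓘(ℝ, E) (𝓘(ℝ, E)).tangent ∞ (T% X)) :
    ∃ X' : Π z : N, TangentSpace 𝓘(ℝ, E') z,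
      (∀ᶠ z in 𝓝 (ι x), ContMDiffAt 𝓘(ℝ, E') (𝓘(ℝ, E')).tangent ∞ (T% X') z) ∧
      ∀ᶠ y in 𝓝 x, X' (ι y) = mfderiv 𝓘(ℝ, E) 𝓘(ℝ, E') ι y (X y) := by
  have i1 : IsManifold 𝓘(ℝ, E) 1 M := isManifold_of_infty 1
  have i2 : IsManifold 𝓘(ℝ, E') 1 N := isManifold_of_infty 1
  obtain ⟨r, hr, hrι⟩ := exists_local_leftInverse h
  let t := trivializationAt E' (TangentSpace 𝓘(ℝ, E') : N → Type _) (ι x)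
  have hxt : ι x ∈ t.baseSet := FiberBundle.mem_baseSet_trivializationAt E' _ (ι x)
  let V : M → TangentBundle 𝓘(ℝ, E') N := fun y ↦ ⟨ι y, mfderiv 𝓘(ℝ, E) 𝓘(ℝ, E') ι y (X y)⟩
  have hV : ContMDiff 𝓘(ℝ, E) (𝓘(ℝ, E')).tangent ∞ V :=
    (hι.contMDiff_tangentMap (m := ∞) (by simp)).comp hX
  let c : M → E' := fun y ↦ (t (V y)).2
  have hc {y} (hy : ι y ∈ t.baseSet) : ContMDiffAt 𝓘(ℝ, E) 𝓘(ℝ, E') ∞ c y :=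
    ((t.contMDiffAt_iff (t.mem_source.2 hy)).1 hV.contMDiffAt).2
  have hrx : r (ι x) = x := hrι.self_of_nhds
  -- The pushed-forward field, read in a trivialization at ι x, is continued as constant along the
  -- fibres of the local left inverse r.
  refine ⟨fun z ↦ t.symm z (c (r z)), ?_, ?_⟩
  · have hrc : ContinuousAt r (ι x) := hr.self_of_nhds.continuousAt
    have hb : ∀ᶠ y in 𝓝 (r (ι x)), ι y ∈ t.baseSet := by
      rw [hrx]
      exact hι.continuous.continuousAt (t.open_baseSet.mem_nhds hxt)
    filter_upwards [hr, hrc.eventually hb, t.open_baseSet.mem_nhds hxt,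
      eventually_mem_nhds_iff.2 (t.open_baseSet.mem_nhds hxt)] with z hz hz' hzt hzn
    rw [t.contMDiffAt_section_iff hzt]
    refine ((hc hz').comp z hz).congr_of_eventuallyEq ?_
    filter_upwards [hzn] with w hw
    change (t ⟨w, t.symm w (c (r w))⟩).2 = c (r w)
    rw [t.apply_mk_symm hw]
  · filter_upwards [hrι, hι.continuous.continuousAt (t.open_baseSet.mem_nhds hxt)] with y hy hyt
    rw [hy]
    exact t.symm_apply_apply_mk hyt _

/-- `X'` extends the push-forward of `X` along `ι` near `x`. -/
structure IsRelatedNear (ι : M → N) (x : M) (X : Π y : M, TangentSpace 𝓘(ℝ, E) y)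
    (X' : Π z : N, TangentSpace 𝓘(ℝ, E') z) : Prop where
  source : ∀ᶠ y in 𝓝 x, ContMDiffAt 𝓘(ℝ, E) (𝓘(ℝ, E)).tangent ∞ (T% X) y
  target : ∀ᶠ z in 𝓝 (ι x), ContMDiffAt 𝓘(ℝ, E') (𝓘(ℝ, E')).tangent ∞ (T% X') z
  apply_eq : ∀ᶠ y in 𝓝 x, X' (ι y) = mfderiv 𝓘(ℝ, E) 𝓘(ℝ, E') ι y (X y)

namespace IsRelatedNear

variable {X Y Z : Π y : M, TangentSpace 𝓘(ℝ, E) y} {X' Y' Z' : Π z : N, TangentSpace 𝓘(ℝ, E') z}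

lemma mdifferentiableAt_source (h : IsRelatedNear ι x X X') : MDiffAt (T% X) x :=
  h.source.self_of_nhds.mdifferentiableAt (by simp)

lemma mdifferentiableAt_target (h : IsRelatedNear ι x X X') : MDiffAt (T% X') (ι x) :=
  h.target.self_of_nhds.mdifferentiableAt (by simp)

/-- Openness of the relation allows identities proved along ι to be differentiated. -/
lemma eventually (hι : ContMDiff 𝓘(ℝ, E) 𝓘(ℝ, E') ∞ ι) (h : IsRelatedNear ι x X X') :
    ∀ᶠ y in 𝓝 x, IsRelatedNear ι y X X' := by
  filter_upwards [eventually_eventually_nhds.2 h.source,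
    hι.continuous.continuousAt.eventually (eventually_eventually_nhds.2 h.target),
    eventually_eventually_nhds.2 h.apply_eq] with y h1 h2 h3
  exact ⟨h1, h2, h3⟩

lemma mvfderiv_apply (hι : ContMDiff 𝓘(ℝ, E) 𝓘(ℝ, E') ∞ ι) (h : IsRelatedNear ι x X X')
    {f : N → ℝ} (hf : MDifferentiableAt 𝓘(ℝ, E') 𝓘(ℝ, ℝ) f (ι x)) :
    mvfderiv 𝓘(ℝ, E') f (ι x) (X' (ι x)) = mvfderiv 𝓘(ℝ, E) (fun y ↦ f (ι y)) x (X x) := by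
  rw [h.apply_eq.self_of_nhds]
  exact (mvfderiv_comp_apply x hf (hι.mdifferentiableAt (by simp)) (X x)).symm

variable [CompleteSpace E] [CompleteSpace E']

/-- Tested on a function f, both sides are the commutator of X and Y acting on f ∘ ι. -/
lemma mlieBracket (hι : ContMDiff 𝓘(ℝ, E) 𝓘(ℝ, E') ∞ ι) (hX : IsRelatedNear ι x X X')
    (hY : IsRelatedNear ι x Y Y') :
    mlieBracket 𝓘(ℝ, E') X' Y' (ι x)
      = mfderiv 𝓘(ℝ, E) 𝓘(ℝ, E') ι x (mlieBracket 𝓘(ℝ, E) X Y x) := by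
  refine eq_of_forall_mvfderiv_eq fun f hf ↦ ?_
  have hfι : ContMDiffAt 𝓘(ℝ, E) 𝓘(ℝ, ℝ) ∞ (fun y ↦ f (ι y)) x := hf.comp x hι.contMDiffAt
  have hdiff : ∀ᶠ y in 𝓝 x, MDifferentiableAt 𝓘(ℝ, E') 𝓘(ℝ, ℝ) f (ι y) := by
    have : ContMDiffAt 𝓘(ℝ, E') 𝓘(ℝ, ℝ) 1 f (ι x) := hf.of_le (by simp)
    filter_upwards [hι.continuous.continuousAt.eventually
      ((contMDiffAt_iff_contMDiffAt_nhds (by simp)).1 this)] with y hy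
    exact ContMDiffAt.mdifferentiableAt hy (by simp)
  have hd {X : Π y : M, TangentSpace 𝓘(ℝ, E) y} {X' : Π z : N, TangentSpace 𝓘(ℝ, E') z}
      (hX : IsRelatedNear ι x X X') :
      (fun y ↦ mvfderiv 𝓘(ℝ, E') f (ι y) (X' (ι y)))
        =ᶠ[𝓝 x] fun y ↦ mvfderiv 𝓘(ℝ, E) (fun y ↦ f (ι y)) y (X y) := by
    filter_upwards [hdiff, hX.eventually hι] with y hy hXy
    exact hXy.mvfderiv_apply hι hy
  have s1 {X : Π y : M, TangentSpace 𝓘(ℝ, E) y} {X' : Π z : N, TangentSpace 𝓘(ℝ, E') z}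
      (hX : IsRelatedNear ι x X X') :
      MDifferentiableAt 𝓘(ℝ, E') 𝓘(ℝ, ℝ) (fun z ↦ mvfderiv 𝓘(ℝ, E') f z (X' z)) (ι x) :=
    (contMDiffAt_mvfderiv hf hX.target.self_of_nhds).mdifferentiableAt (by simp)
  have s2 {X : Π y : M, TangentSpace 𝓘(ℝ, E) y} {X' : Π z : N, TangentSpace 𝓘(ℝ, E') z}
      (hX : IsRelatedNear ι x X X') : MDifferentiableAt 𝓘(ℝ, E) 𝓘(ℝ, ℝ)
      (fun y ↦ mvfderiv 𝓘(ℝ, E) (fun y ↦ f (ι y)) y (X y)) x :=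
    (contMDiffAt_mvfderiv hfι hX.source.self_of_nhds).mdifferentiableAt (by simp)
  rw [mvfderiv_mlieBracket hf hX.mdifferentiableAt_target hY.mdifferentiableAt_target (s1 hX) (s1 hY), hX.mvfderiv_apply hι (s1 hY),
    hY.mvfderiv_apply hι (s1 hX), mvfderiv_congr (hd hX), mvfderiv_congr (hd hY)]
  have h2 := mvfderiv_comp_apply x (hf.mdifferentiableAt (by simp))
    (hι.mdifferentiableAt (x := x) (by simp)) (VectorField.mlieBracket 𝓘(ℝ, E) X Y x)
  rw [← h2]
  exact (mvfderiv_mlieBracket hfι hX.mdifferentiableAt_source hY.mdifferentiableAt_source (s2 hX) (s2 hY)).symm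

variable {g : PseudoRiemannianMetric 𝓘(ℝ, E') N} {h : PseudoRiemannianMetric 𝓘(ℝ, E) M}

omit [CompleteSpace E] [CompleteSpace E'] in
lemma eventually_inner (iso : ∀ y v w, g.inner (ι y) (mfderiv 𝓘(ℝ, E) 𝓘(ℝ, E') ι y v)
      (mfderiv 𝓘(ℝ, E) 𝓘(ℝ, E') ι y w) = h.inner y v w)
    (hX : IsRelatedNear ι x X X') (hY : IsRelatedNear ι x Y Y') :
    (fun y ↦ g.inner (ι y) (X' (ι y)) (Y' (ι y))) =ᶠ[𝓝 x] fun y ↦ h.inner y (X y) (Y y) := by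
  filter_upwards [hX.apply_eq, hY.apply_eq] with y h1 h2
  rw [h1, h2, iso]

/-- The tangential part of the Levi-Civita connection of the ambient space. -/
lemma inner_leviCivita [FiniteDimensional ℝ E] [FiniteDimensional ℝ E']
    (hι : ContMDiff 𝓘(ℝ, E) 𝓘(ℝ, E') ∞ ι)
    (iso : ∀ y v w, g.inner (ι y) (mfderiv 𝓘(ℝ, E) 𝓘(ℝ, E') ι y v)
      (mfderiv 𝓘(ℝ, E) 𝓘(ℝ, E') ι y w) = h.inner y v w)
    (hX : IsRelatedNear ι x X X') (hY : IsRelatedNear ι x Y Y') (hZ : IsRelatedNear ι x Z Z') :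
    g.inner (ι x) (g.leviCivita Y' (ι x) (X' (ι x))) (Z' (ι x))
      = h.inner x (h.leviCivita Y x (X x)) (Z x) := by
  have d {X Y Z : Π y : M, TangentSpace 𝓘(ℝ, E) y}
      {X' Y' Z' : Π z : N, TangentSpace 𝓘(ℝ, E') z} (hX : IsRelatedNear ι x X X') (hY : IsRelatedNear ι x Y Y')
      (hZ : IsRelatedNear ι x Z Z') :
      mvfderiv 𝓘(ℝ, E') (fun z ↦ g.inner z (Y' z) (Z' z)) (ι x) (X' (ι x))
        = mvfderiv 𝓘(ℝ, E) (fun y ↦ h.inner y (Y y) (Z y)) x (X x) := by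
    rw [hX.mvfderiv_apply hι (g.mdifferentiableAt hY.mdifferentiableAt_target hZ.mdifferentiableAt_target),
      mvfderiv_congr (eventually_inner iso hY hZ)]
  have b {X Y Z : Π y : M, TangentSpace 𝓘(ℝ, E) y}
      {X' Y' Z' : Π z : N, TangentSpace 𝓘(ℝ, E') z} (hX : IsRelatedNear ι x X X') (hY : IsRelatedNear ι x Y Y')
      (hZ : IsRelatedNear ι x Z Z') :
      g.inner (ι x) (VectorField.mlieBracket 𝓘(ℝ, E') X' Y' (ι x)) (Z' (ι x))
        = h.inner x (VectorField.mlieBracket 𝓘(ℝ, E) X Y x) (Z x) := by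
    rw [mlieBracket hι hX hY, hZ.apply_eq.self_of_nhds, iso]
  rw [g.inner_leviCivita hX.mdifferentiableAt_target hY.mdifferentiableAt_target hZ.mdifferentiableAt_target, h.inner_leviCivita hX.mdifferentiableAt_source hY.mdifferentiableAt_source hZ.mdifferentiableAt_source]
  -- Each Koszul term involves only tangential derivatives, products and brackets of related fields,
  -- so it agrees with its intrinsic counterpart.
  simp only [PseudoRiemannianMetric.koszul]
  rw [d hX hY hZ, d hY hX hZ, d hZ hX hY, b hX hY hZ, b hX hZ hY, b hY hZ hX]

end IsRelatedNear

end Immersions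

/-! ### The Gauss equation of a hypersurface in a Ricci-flat spacetime. -/

section Hypersurface

variable {M : Type*} [TopologicalSpace M] [ChartedSpace (EuclideanSpace ℝ (Fin 3)) M]
  [IsManifold (𝓡 3) ∞ M] {N : Type*} [TopologicalSpace N]
  [ChartedSpace (EuclideanSpace ℝ (Fin 4)) N] [IsManifold (𝓡 4) ∞ N]
  {g : PseudoRiemannianMetric (𝓡 4) N}

/-- The signs of the Minkowski metric. -/
def minkowskiSign (i : Fin 4) : ℝ := if i = 0 then -1 else 1

lemma minkowskiSign_mul_self (i : Fin 4) : minkowskiSign i * minkowskiSign i = 1 := by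
  unfold minkowskiSign
  split_ifs <;> norm_num

/-- Smooth fields which are orthonormal at a point form a frame nearby. -/
lemma exists_isLocalFrameOn {f : Fin 4 → Π z : N, TangentSpace (𝓡 4) z} {p : N}
    (hf : ∀ i, ∀ᶠ z in 𝓝 p, ContMDiffAt (𝓡 4) (𝓡 4).tangent ∞ (T% (f i)) z)
    (horth : ∀ i j, g.inner p (f i p) (f j p) = if i = j then minkowskiSign i else 0) :
    ∃ u, IsOpen u ∧ p ∈ u ∧ IsLocalFrameOn (𝓡 4) (EuclideanSpace ℝ (Fin 4)) ∞ f u := by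
  let G : N → Matrix (Fin 4) (Fin 4) ℝ := fun z ↦ Matrix.of fun i j ↦ g.inner z (f i z) (f j z)
  have hG : ContMDiffAt (𝓡 4) 𝓘(ℝ, ℝ) ∞ (fun z ↦ (G z).det) p :=
    contMDiffAt_det fun i j ↦ g.contMDiffAt_inner (hf i).self_of_nhds (hf j).self_of_nhds
  -- At p the Gram matrix is the diagonal matrix of signs; nonvanishing of its determinant persists
  -- nearby, although orthonormality need not.
  have hGp : (G p).det ≠ 0 := by
    have : G p = Matrix.diagonal minkowskiSign := by
      ext i j
      simp [G, horth, Matrix.diagonal_apply]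
    rw [this, Matrix.det_diagonal]
    refine Finset.prod_ne_zero_iff.2 fun i _ h ↦ ?_
    have := minkowskiSign_mul_self i
    rw [h] at this
    norm_num at this
  obtain ⟨u, hu, huo, hpu⟩ := mem_nhds_iff.1
    ((hG.continuousAt.eventually_ne hGp).and (Filter.eventually_all.2 hf))
  have hli {z} (hz : z ∈ u) : LinearIndependent ℝ (f · z) := by
    rw [Fintype.linearIndependent_iff]
    intro c hc i
    refine congrFun (Matrix.eq_zero_of_vecMul_eq_zero (M := G z) (hu hz).1 (v := c) ?_) i
    ext j
    have := congrArg (fun v ↦ g.inner z v (f j z)) hc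
    simpa [Matrix.vecMul, dotProduct, G] using this
  refine ⟨u, huo, hpu, ⟨hli, fun {z} hz ↦ ?_, fun i z hz ↦ ((hu hz).2 i).contMDiffWithinAt⟩⟩
  have : FiniteDimensional ℝ (TangentSpace (𝓡 4) z) :=
    inferInstanceAs (FiniteDimensional ℝ (EuclideanSpace ℝ (Fin 4)))
  refine ((hli hz).span_eq_top_of_card_eq_finrank' ?_).ge
  change _ = Module.finrank ℝ (EuclideanSpace ℝ (Fin 4))
  simp

variable {u : Set N} {f : Fin 4 → Π z : N, TangentSpace (𝓡 4) z} {p : N}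

lemma coeff_eq_inner (hs : IsLocalFrameOn (𝓡 4) (EuclideanSpace ℝ (Fin 4)) ∞ f u) (hp : p ∈ u)
    (horth : ∀ i j, g.inner p (f i p) (f j p) = if i = j then minkowskiSign i else 0)
    (v : Π z : N, TangentSpace (𝓡 4) z) (i : Fin 4) :
    hs.coeff i p (v p) = minkowskiSign i * g.inner p (v p) (f i p) := by
  have h : g.inner p (v p) (f i p) = hs.coeff i p (v p) * minkowskiSign i := by
    conv_lhs => rw [hs.coeff_sum_eq v hp]
    simp [_root_.sum_apply, horth]
  rw [h, mul_left_comm, minkowskiSign_mul_self, mul_one]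

lemma inner_eq_sum_frame (hs : IsLocalFrameOn (𝓡 4) (EuclideanSpace ℝ (Fin 4)) ∞ f u) (hp : p ∈ u)
    (horth : ∀ i j, g.inner p (f i p) (f j p) = if i = j then minkowskiSign i else 0)
    (v w : TangentSpace (𝓡 4) p) :
    g.inner p v w = ∑ i, minkowskiSign i * (g.inner p v (f i p) * g.inner p w (f i p)) := by
  have hv := hs.coeff_sum_eq (FiberBundle.extend (EuclideanSpace ℝ (Fin 4)) v) hp
  have hc (i) : hs.coeff i p v = minkowskiSign i * g.inner p v (f i p) := by
    have := coeff_eq_inner hs hp horth (FiberBundle.extend (EuclideanSpace ℝ (Fin 4)) v) i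
    rwa [FiberBundle.extend_apply_self] at this
  simp only [FiberBundle.extend_apply_self, hc] at hv
  conv_lhs => rw [hv]
  simp only [map_sum, map_smul, _root_.sum_apply, smul_apply, smul_eq_mul,
    g.symm p _ w]
  exact Finset.sum_congr rfl fun i _ ↦ by ring

/-- In a Ricci flat spacetime the scalar curvature of the space orthogonal to `f 0` vanishes. -/
lemma sum_inner_curvature_eq_zero (hg : IsRicciFlat g) (hu : IsOpen u)
    (hs : IsLocalFrameOn (𝓡 4) (EuclideanSpace ℝ (Fin 4)) ∞ f u) (hp : p ∈ u)
    (horth : ∀ i j, g.inner p (f i p) (f j p) = if i = j then minkowskiSign i else 0) :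
    ∑ a : Fin 3, ∑ b : Fin 3, g.inner p (curvature g.leviCivita (f a.succ) (f b.succ) (f a.succ) p)
      (f b.succ p) = 0 := by
  let R (i j k l : Fin 4) : ℝ := g.inner p (curvature g.leviCivita (f i) (f j) (f k) p) (f l p)
  have hc := hs.contMDiffOn
  have hR1 (i j k l) : R i j k l = - R j i k l := by
    simp only [R]
    rw [curvature_swap, map_neg, neg_apply]
  have hR2 (i j k l) : R i j k l = - R i j l k :=
    g.inner_curvature_antisymm hu (hc i) (hc j) (hc k) (hc l) hp
  have hric (j k) : ∑ i, minkowskiSign i * R i j k i = 0 := by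
    have := hg u hu f hs (f j) (f k) (hc j) (hc k) p hp
    rw [ricci] at this
    rw [← this]
    exact Finset.sum_congr rfl fun i _ ↦
      (coeff_eq_inner hs hp horth (curvature g.leviCivita (f i) (f j) (f k)) i).symm
  have h00 : R 0 0 0 0 = 0 := by linarith [hR1 0 0 0 0]
  have hn := hric 0 0
  rw [Fin.sum_univ_succ, h00, mul_zero, zero_add] at hn
  -- This is Ric(f_b, f_b) = 0, the minus sign of the timelike direction moving its term across.
  -- Summing over b, the left side becomes Ric(f_0, f_0) = 0 by the pair antisymmetries.
  have hb (b : Fin 3) : R 0 b.succ b.succ 0 = ∑ a : Fin 3, R a.succ b.succ b.succ a.succ := by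
    have := hric b.succ b.succ
    rw [Fin.sum_univ_succ] at this
    simp [minkowskiSign] at this
    linarith
  have hn' : ∑ b : Fin 3, R 0 b.succ b.succ 0 = 0 := by
    rw [← hn]
    refine Finset.sum_congr rfl fun b _ ↦ ?_
    rw [hR1, hR2 b.succ 0 b.succ 0]
    simp [minkowskiSign]
  change ∑ a : Fin 3, ∑ b : Fin 3, R a.succ b.succ a.succ b.succ = 0
  rw [Finset.sum_comm]
  simp only [hb] at hn'
  rw [← neg_eq_zero, ← hn', ← Finset.sum_neg_distrib]
  refine Finset.sum_congr rfl fun b _ ↦ ?_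
  rw [← Finset.sum_neg_distrib]
  exact Finset.sum_congr rfl fun a _ ↦ by rw [hR2, neg_neg]

namespace IsHypersurface

variable {q : Metric M} {W : Π x : M, TangentSpace (𝓡 3) x →ₗ[ℝ] TangentSpace (𝓡 3) x}
  {ι : M → N} {n : Π y : N, TangentSpace (𝓡 4) y} {x : M}
  {X Y : Π x : M, TangentSpace (𝓡 3) x} {X' Y' : Π z : N, TangentSpace (𝓡 4) z}

lemma eventually_contMDiffAt_normal (h : IsHypersurface g q W ι n) (x : M) :
    ∀ᶠ z in 𝓝 (ι x), ContMDiffAt (𝓡 4) (𝓡 4).tangent ∞ (T% n) z := by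
  obtain ⟨U, hU, hUι, hn⟩ := h.smooth_normal
  filter_upwards [hU.mem_nhds (hUι ⟨x, rfl⟩)] with z hz
  exact hn.contMDiffAt (hU.mem_nhds hz)

/-- The normal part of the Levi-Civita connection of the ambient space. -/
lemma inner_leviCivita_normal (h : IsHypersurface g q W ι n)
    (hX : IsRelatedNear (E := EuclideanSpace ℝ (Fin 3)) (E' := EuclideanSpace ℝ (Fin 4)) ι x X X')
    (hY : IsRelatedNear (E := EuclideanSpace ℝ (Fin 3)) (E' := EuclideanSpace ℝ (Fin 4)) ι x Y Y') :
    g.inner (ι x) (g.leviCivita Y' (ι x) (X' (ι x))) (n (ι x)) = - q.inner x (W x (X x)) (Y x) := by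
  have hn : MDifferentiableAt (𝓡 4) (𝓡 4).tangent (T% n) (ι x) :=
    (h.eventually_contMDiffAt_normal x).self_of_nhds.mdifferentiableAt (by simp)
  have hm := g.isLeviCivita_leviCivita.metric hn hY.mdifferentiableAt_target (X' (ι x))
  -- Orthogonality holds only along the hypersurface, which suffices because it is differentiated in
  -- the tangential direction X'.
  have h0 : (fun y ↦ g.inner (ι y) (n (ι y)) (Y' (ι y))) =ᶠ[𝓝 x] fun _ ↦ (0 : ℝ) := by
    filter_upwards [hY.apply_eq] with y hy
    rw [hy, h.normal]
  rw [hX.mvfderiv_apply h.embedding.contMDiff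
    (g.mdifferentiableAt hn hY.mdifferentiableAt_target), mvfderiv_congr h0, mvfderiv_const,
    hX.apply_eq.self_of_nhds, ← h.weingarten, hY.apply_eq.self_of_nhds, h.isometric,
    g.symm _ (n (ι x))] at hm
  rw [hX.apply_eq.self_of_nhds]
  simp only [zero_apply] at hm
  linarith

variable {d : Dreibein q} {β : ℝ} {A : Fin 3 → OneForm M}

/-- The Gauss equation is proved for each pair of frame vectors and summed; Ricci-flatness makes the
ambient side vanish. Here n and the extended dreibein form an ambient frame near ι x, required to be
orthonormal only at that point. -/
theorem gaussExpr_eq_zero (h : IsHypersurface g q (d.W β A) ι n) (hg : IsRicciFlat g) (x : M) :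
    d.gaussExpr β A x = 0 := by
  have hι := h.embedding.contMDiff
  have hex (a : Fin 3) := exists_extension (E := EuclideanSpace ℝ (Fin 3))
    (E' := EuclideanSpace ℝ (Fin 4)) hι (h.embedding.isImmersion.isImmersionAt x) (d.contMDiff a)
  choose e' he'1 he'2 using hex
  have hrel (a : Fin 3) : IsRelatedNear (E := EuclideanSpace ℝ (Fin 3))
      (E' := EuclideanSpace ℝ (Fin 4)) ι x (d.e a) (e' a) :=
    ⟨.of_forall fun y ↦ d.contMDiff a y, he'1 a, he'2 a⟩
  have iso : ∀ y v w, g.inner (ι y) (mfderiv (𝓡 3) (𝓡 4) ι y v) (mfderiv (𝓡 3) (𝓡 4) ι y w)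
      = (toPseudo q).inner y v w := h.isometric
  let f : Fin 4 → Π z : N, TangentSpace (𝓡 4) z :=
    Fin.cons (α := fun _ ↦ Π z : N, TangentSpace (𝓡 4) z) n e'
  have hf : ∀ i, ∀ᶠ z in 𝓝 (ι x), ContMDiffAt (𝓡 4) (𝓡 4).tangent ∞ (T% (f i)) z :=
    Fin.cases (h.eventually_contMDiffAt_normal x) he'1
  have hne (a) : g.inner (ι x) (n (ι x)) (e' a (ι x)) = 0 := by
    rw [(hrel a).apply_eq.self_of_nhds, h.normal]
  have hee (a b) : g.inner (ι x) (e' a (ι x)) (e' b (ι x)) = if a = b then 1 else 0 := by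
    rw [(hrel a).apply_eq.self_of_nhds, (hrel b).apply_eq.self_of_nhds, h.isometric, d.orthonormal]
  have horth : ∀ i j, g.inner (ι x) (f i (ι x)) (f j (ι x))
      = if i = j then minkowskiSign i else 0 := by
    intro i j
    refine Fin.cases ?_ (fun a ↦ ?_) i <;> refine Fin.cases ?_ (fun b ↦ ?_) j
    · simp [f, minkowskiSign, h.unit]
    · simp [f, hne, (Fin.succ_ne_zero b).symm]
    · simp [f, g.symm _ (e' a (ι x)), hne]
    · simp [f, hee, minkowskiSign]
  obtain ⟨u, hu, hp, hs⟩ := exists_isLocalFrameOn hf horth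
  have hc (a : Fin 3) : ContMDiffOn (𝓡 4) (𝓡 4).tangent ∞ (T% (e' a)) u := hs.contMDiffOn a.succ
  have htan {y : M} (a b c : Fin 3) (hy : ∀ a, IsRelatedNear (E := EuclideanSpace ℝ (Fin 3))
      (E' := EuclideanSpace ℝ (Fin 4)) ι y (d.e a) (e' a)) :
      g.inner (ι y) (g.leviCivita (e' b) (ι y) (e' a (ι y))) (e' c (ι y))
        = q.inner y (d.nabla (d.e b) y (d.e a y)) (d.e c y) :=
    IsRelatedNear.inner_leviCivita hι iso (hy a) (hy b) (hy c)
  have hder (a b c c' : Fin 3) :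
      mvfderiv (𝓡 4) (fun z ↦ g.inner z (g.leviCivita (e' c) z (e' b z)) (e' c' z)) (ι x)
        (e' a (ι x)) = mvfderiv (𝓡 3)
          (fun y ↦ q.inner y (d.nabla (d.e c) y (d.e b y)) (d.e c' y)) x (d.e a x) := by
    rw [(hrel a).mvfderiv_apply hι (g.mdifferentiableAt
      (g.mdifferentiableAt_leviCivita hu (hc b) (hc c) hp) (hrel c').mdifferentiableAt_target)]
    congr 1
    refine mvfderiv_congr ?_
    filter_upwards [Filter.eventually_all.2 fun a ↦ (hrel a).eventually hι] with y hy
    exact htan b c c' hy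
  -- This is where the second fundamental form enters: the product splits into tangential and normal
  -- parts, and the timelike normal contributes with sign -1.
  have hprod (a b c c' : Fin 3) :
      g.inner (ι x) (g.leviCivita (e' b) (ι x) (e' a (ι x)))
          (g.leviCivita (e' c') (ι x) (e' c (ι x)))
        = q.inner x (d.nabla (d.e b) x (d.e a x)) (d.nabla (d.e c') x (d.e c x))
          - q.inner x (d.W β A x (d.e a x)) (d.e b x)
            * q.inner x (d.W β A x (d.e c x)) (d.e c' x) := by
    rw [inner_eq_sum_frame hs hp horth, Fin.sum_univ_succ, d.inner_eq_sum]
    have h0 : f 0 = n := rfl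
    have hS (m : Fin 3) : f m.succ = e' m := rfl
    simp only [h0, hS, htan _ _ _ hrel, h.inner_leviCivita_normal (hrel _) (hrel _), minkowskiSign,
      Fin.succ_ne_zero, if_true, if_false, one_mul, Dreibein.coframe, q.symm x (d.e _ x)]
    ring
  -- The bracket of the extensions is tangent to the hypersurface at ι x, so it can be expanded in
  -- the extended dreibein and contributes no normal term.
  have hbr (a b c c' : Fin 3) :
      g.inner (ι x) (g.leviCivita (e' c) (ι x) (mlieBracket (𝓡 4) (e' a) (e' b) (ι x))) (e' c' (ι x))
        = q.inner x (d.nabla (d.e c) x (mlieBracket (𝓡 3) (d.e a) (d.e b) x)) (d.e c' x) := by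
    have h1 := IsRelatedNear.mlieBracket hι (hrel a) (hrel b)
    have h2 : mfderiv (𝓡 3) (𝓡 4) ι x (mlieBracket (𝓡 3) (d.e a) (d.e b) x)
        = ∑ m, d.coframe m x (mlieBracket (𝓡 3) (d.e a) (d.e b) x) • e' m (ι x) := by
      conv_lhs => rw [← d.sum_coframe_smul (mlieBracket (𝓡 3) (d.e a) (d.e b) x)]
      rw [map_sum]
      exact Finset.sum_congr rfl fun m _ ↦ by rw [map_smul, (hrel m).apply_eq.self_of_nhds]
    erw [h1]
    rw [h2]
    conv_rhs => rw [← d.sum_coframe_smul (mlieBracket (𝓡 3) (d.e a) (d.e b) x)]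
    simp only [map_sum, map_smul, _root_.sum_apply, smul_apply, htan _ _ _ hrel]
  have hgauss (a b : Fin 3) :
      g.inner (ι x) (curvature g.leviCivita (e' a) (e' b) (e' a) (ι x)) (e' b (ι x))
        = q.inner x (curvature d.nabla (d.e a) (d.e b) (d.e a) x) (d.e b x)
          + q.inner x (d.W β A x (d.e b x)) (d.e a x) * q.inner x (d.W β A x (d.e a x)) (d.e b x)
          - q.inner x (d.W β A x (d.e a x)) (d.e a x)
            * q.inner x (d.W β A x (d.e b x)) (d.e b x) := by
    have hq : q.inner x (curvature d.nabla (d.e a) (d.e b) (d.e a) x) (d.e b x)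
        = mvfderiv (𝓡 3) (fun y ↦ q.inner y (d.nabla (d.e a) y (d.e b y)) (d.e b y)) x (d.e a x)
          - q.inner x (d.nabla (d.e a) x (d.e b x)) (d.nabla (d.e b) x (d.e a x))
          - (mvfderiv (𝓡 3) (fun y ↦ q.inner y (d.nabla (d.e a) y (d.e a y)) (d.e b y)) x (d.e b x)
            - q.inner x (d.nabla (d.e a) x (d.e a x)) (d.nabla (d.e b) x (d.e b x)))
          - q.inner x (d.nabla (d.e a) x (mlieBracket (𝓡 3) (d.e a) (d.e b) x)) (d.e b x) :=
      (toPseudo q).inner_curvature isOpen_univ (d.contMDiff a).contMDiffOn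
        (d.contMDiff b).contMDiffOn (d.contMDiff a).contMDiffOn (d.mdifferentiableAt_e b)
        (Set.mem_univ x)
    rw [g.inner_curvature hu (hc a) (hc b) (hc a) (hrel b).mdifferentiableAt_target hp, hder, hder,
      hprod, hprod, hbr, hq]
    ring
  have hzero := sum_inner_curvature_eq_zero hg hu hs hp horth
  have hS (m : Fin 3) : f m.succ = e' m := rfl
  simp only [hS, hgauss] at hzero
  have hW (a : Fin 3) (v : TangentSpace (𝓡 3) x) :
      q.inner x (d.W β A x v) (d.e a x) = d.K β A a x v := by
    simp [Dreibein.W, LinearMap.sum_apply, _root_.sum_apply, d.orthonormal]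
  simp only [hW, Finset.sum_add_distrib, Finset.sum_sub_distrib] at hzero
  rw [← hzero, Dreibein.gaussExpr, Dreibein.scalR, d.trace_W, d.trace_W_comp_W, sq,
    Finset.sum_mul_sum]
  congr 2
  exact Finset.sum_congr rfl fun a _ ↦ Finset.sum_congr rfl fun b _ ↦ mul_comm _ _

end IsHypersurface

end Hypersurface

end Ashtekar

end

theorem mainTheorem3 {M : Type*} [TopologicalSpace M]
    [ChartedSpace (EuclideanSpace ℝ (Fin 3)) M] [IsManifold (𝓡 3) ∞ M]
    (q : Ashtekar.Metric M) (d : Ashtekar.Dreibein q)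
    (A : Fin 3 → Ashtekar.OneForm M) (hA : ∀ a, (A a).Smooth) (β : ℝ) (hβ : β ≠ 0) :
    -- coordinate expression of the scalar constraint in positively oriented charts
    (∀ φ ∈ IsManifold.maximalAtlas (𝓡 3) ∞ M, ∀ y ∈ φ.target, 0 < (d.eUp φ y).det →
      d.scalarConstraint β A (φ.symm y)
        = (-(1 / 2) * d.scalarCoord φ β A y) • d.dx₁₂₃ φ (φ.symm y)) ∧
    -- decomposition of the field strength
    (∀ x, d.fieldStrength A x = d.fieldStrength d.Gam x + β • d.dForm (d.K β A) x
      + β • d.bracket d.Gam (d.K β A) x + (β ^ 2 / 2) • d.bracket (d.K β A) (d.K β A) x) ∧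
    -- reduction when the Gauss constraint holds
    ((∀ a x, d.gauss A a x = 0) →
      (∀ x, d.scalarConstraint β A x = d.trStarWedge
        (d.fieldStrength d.Gam x - (1 / 2 : ℝ) • d.bracket (d.K β A) (d.K β A) x)) ∧
      (∀ x, d.scalarConstraint β A x = (-(1 / 2) * d.gaussExpr β A x) • d.vol x) ∧
      (∀ x, d.scalarConstraint β A x = 0 ↔ d.gaussExpr β A x = 0) ∧
      (∀ φ ∈ IsManifold.maximalAtlas (𝓡 3) ∞ M, ∀ y ∈ φ.target, ∀ k : ℝ, k ≠ 0 →
        d.superHamiltonian φ k β A y = d.sqrtq φ y / k * d.gaussExpr β A (φ.symm y) ∧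
        (d.scalarConstraint β A (φ.symm y) = 0 ↔ d.superHamiltonian φ k β A y = 0))) ∧
    -- Gauss equation for hypersurfaces of Ricci-flat spacetimes
    (∀ (N : Type*) [TopologicalSpace N] [ChartedSpace (EuclideanSpace ℝ (Fin 4)) N]
      [IsManifold (𝓡 4) ∞ N] (g : Ashtekar.PseudoRiemannianMetric (𝓡 4) N)
      (ι : M → N) (n : Π y : N, TangentSpace (𝓡 4) y),
      Ashtekar.IsLorentzian g → Ashtekar.IsRicciFlat g →
      Ashtekar.IsHypersurface g q (d.W β A) ι n → ∀ x, d.gaussExpr β A x = 0) := by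
  refine ⟨fun φ hφ y hy hpos ↦ d.scalarConstraint_chart hA β hφ hy hpos,
    d.fieldStrength_eq hA hβ, fun hG ↦ ⟨d.scalarConstraint_eq hA hβ hG,
      d.scalarConstraint_eq_smul_vol hA hβ hG, d.scalarConstraint_eq_zero_iff hA hβ hG,
      fun φ hφ y hy k hk ↦ ⟨d.superHamiltonian_eq hβ hG hφ hy hk,
        d.scalarConstraint_eq_zero_iff_superHamiltonian hA hβ hG hφ hy hk⟩⟩,
    fun N _ _ _ g ι n _ hg h x ↦ h.gaussExpr_eq_zero hg x⟩
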